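/- **Theorem (Classification of first order asymptotic exceptional points of a dimer when $\rho$ and $\kappa$ are modulated).** *System.* Let $\delta,|D_1|,\Omega>0$, $T=2\pi/\Omega$, and let $C=\begin{pmatrix}C_{11}&C_{12}\\ \overline{C_{12}}&C_{22}\end{pmatrix}$ be a Hermitian matrix (the capacitance matrix). Let $\gamma_i,\eta_i:\mathbb R\to\mathbb R$ ($i=1,2$) have finite Fourier series of frequency $\Omega$, write $f^{(n)}$ for the coefficient of $e^{\mathrm i n\Omega t}$ in $f$, and assume $\gamma_1^{(0)}=\gamma_2^{(0)}=0$. Put $1/\kappa_i=1+\epsilon\gamma_i$, $1/\rho_i=1+\epsilon\eta_i$, $\delta_i=\delta\rho_i$, $v_i=\sqrt{\kappa_i/\rho_i}$, and consider the Hill system $\Psi''+M_\epsilon(t)\Psi=0$ in $\mathbb C^2$ with $M_\epsilon=W_1CW_2+W_3$, where $W_1,W_2,W_3$ are diagonal with $$(W_1)_{ii}=\frac{v_i\delta_i^{3/2}}{|D_1|},\qquad (W_2)_{ii}=\frac{v_i}{\sqrt{\delta_i}},\qquad (W_3)_{ii}=\frac{\sqrt{\delta_i}\,v_i}{2}\frac{d}{dt}\left(\frac{1}{(\delta_iv_i^2)^{3/2}}\frac{d(\delta_iv_i^2)}{dt}\right).$$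 Let $\alpha=\sqrt{(C_{11}-C_{22})^2+4|C_{12}|^2}$ and $s_\pm=\sqrt{C_{11}+C_{22}\pm\alpha}$, and assume that $C_{12}\neq0$ and that $s_\pm$ are real with $\dfrac{s_+-s_-}{s_++s_-}\notin\mathbb Q$. Write the Hill system as a first order system for $(\Psi,\Psi')\in\mathbb C^4$ and let $dx/dt=A_\epsilon(t)x$ be this system in any basis of $\mathbb C^4$ (independent of $t$ and $\epsilon$) in which its leading order is $$A_0=\mathrm i\sqrt{\frac{\delta}{2|D_1|}}\,\operatorname{diag}(-s_+,\,s_+,\,-s_-,\,s_-).$$ *First order asymptotic exceptional point.* Let $F_0$ be the diagonal matrix with $F_0\equiv A_0$ modulo $\frac{2\pi \mathrm i}{T}\mathbb Z$ on the diagonal and imaginary parts in $(-\pi/T,\pi/T]$, and let $F_0+\epsilon F_1+O(\epsilon^2)$ be the Floquet exponent matrix of the system, i.e. $F_1$ is the constant matrix such that $\frac{dP_0}{dt}=A_0P_0-P_0F_0$ and $\frac{dP_1}{dt}=A_0P_1-P_1F_0+A_1P_0-P_0F_1$ have $T$-periodic solutions with $P_0(0)=\mathrm{Id}$, $P_1(0)=0$,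 where $A_1(t)=\partial_\epsilon A_\epsilon(t)|_{\epsilon=0}$. The system is *posed at a first order asymptotic exceptional point* if for all $\epsilon>0$ its first order effective Hamiltonian is not diagonalizable; this is the direct sum, over the distinct eigenvalues $\mu$ of $F_0$, of the blocks of $F_0+\epsilon F_1$ with row and column indices in $\{j:(F_0)_{jj}=\mu\}$. *Claim.* Let $$R=\frac{\sqrt{C_{11}C_{22}-|C_{12}|^2}}{\sqrt{(C_{11}-C_{22})^2+4|C_{12}|^2}}.$$ The following are equivalent: 1. The system $dx/dt=A_\epsilon(t)x$ is posed at a first order asymptotic exceptional point. 2. One of the following holds. - (a) For some integer $n\ge1$, $\ \Omega=\dfrac1n\sqrt{\dfrac{\delta}{2|D_1|}}\left(\sqrt{C_{11}+C_{22}+\alpha}-\sqrt{C_{11}+C_{22}-\alpha}\right)$, and exactly one of the two equations $-R\,(\gamma_1-\gamma_2)^{(n)}=(\eta_1-\eta_2)^{(n)}$ and $R\,(\gamma_1-\gamma_2)^{(n)}=(\eta_1-\eta_2)^{(n)}$ holds. - (b) For some integer $n\ge1$, $\ \Omega=\dfrac1n\sqrt{\dfrac{\delta}{2|D_1|}}\left(\sqrt{C_{11}+C_{22}+\alpha}+\sqrt{C_{11}+C_{22}-\alpha}\right)$,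 and exactly one of the same two equations holds. Moreover, $\Omega$ has the form in (a) for some $n\ge1$ if and only if $(F_0)_{11}=(F_0)_{33}$ and $(F_0)_{22}=(F_0)_{44}$, and it has the form in (b) for some $n\ge1$ if and only if $(F_0)_{11}=(F_0)_{44}$ and $(F_0)_{22}=(F_0)_{33}$. -/

import Mathlib

/-! ### Asymptotic exceptional points of periodic linear systems -/

/-- The folding number of `z` for the period `T`: the integer `n` such that the imaginary part of
`z - (2πi/T) n` lies in `(-π/T, π/T]`. -/
noncomputable def foldingNumber (T : ℝ) (z : ℂ) : ℤ := ⌈T * z.im / (2 * Real.pi) - 1 / 2⌉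

/-- The constant order Floquet exponent matrix `F₀` of a system with diagonal leading order `A₀`:
the diagonal of `A₀` folded modulo `2πi/T` into the strip `Im ∈ (-π/T, π/T]`. -/
noncomputable def constantOrderFloquet {ι : Type*} [DecidableEq ι] (T : ℝ) (A₀ : Matrix ι ι ℂ) :
    Matrix ι ι ℂ :=
  Matrix.diagonal fun k =>
    A₀ k k - (2 * Real.pi * Complex.I / T) * (foldingNumber T (A₀ k k) : ℂ)

/-- The first order Taylor coefficient `A₁(t)` in `ε` of `A_ε(t)`. -/
noncomputable def firstOrderCoeff {ι : Type*} (A : ℝ → ℝ → Matrix ι ι ℂ) (t : ℝ) : Matrix ι ι ℂ :=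
  Matrix.of fun k l => deriv (fun ε : ℝ => A ε t k l) 0

/-- `F₀ + ε F₁` and `P₀(t) + ε P₁(t)` are the expansion to first order of the Floquet–Lyapunov
decomposition `P_ε(t) exp(F_ε t)` of the fundamental solution of `dx/dt = A_ε(t) x`: they solve
`dP/dt = A P - P F`, `P(0) = 1`, with `P` of period `T`, to the orders `ε⁰` and `ε¹`. -/
def IsFirstOrderFloquet {ι : Type*} [Fintype ι] [DecidableEq ι] (T : ℝ)
    (A₀ : Matrix ι ι ℂ) (A₁ : ℝ → Matrix ι ι ℂ) (F₀ F₁ : Matrix ι ι ℂ) : Prop :=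
  ∃ P₀ P₁ : ℝ → Matrix ι ι ℂ,
    P₀ 0 = 1 ∧ P₁ 0 = 0 ∧ Function.Periodic P₀ T ∧ Function.Periodic P₁ T ∧
    (∀ t k l, HasDerivAt (fun s => P₀ s k l) ((A₀ * P₀ t - P₀ t * F₀) k l) t) ∧
    (∀ t k l, HasDerivAt (fun s => P₁ s k l)
      ((A₀ * P₁ t - P₁ t * F₀ + A₁ t * P₀ t - P₀ t * F₁) k l) t)

/-- The first order effective Hamiltonian: the direct sum, over the eigenvalues `μ` of the diagonal
matrix `F₀`, of the restrictions of `F₀ + ε F₁` to the eigenspaces `span {e_j | (F₀)_jj = μ}`. -/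
noncomputable def effectiveHamiltonian {ι : Type*} (F₀ F₁ : Matrix ι ι ℂ) (ε : ℝ) :
    Matrix ι ι ℂ :=
  open Classical in
  Matrix.of fun k l => if F₀ k k = F₀ l l then F₀ k l + ε * F₁ k l else 0

/-- A square matrix is diagonalizable if it is similar to a diagonal matrix. -/
def IsDiagonalizableMatrix {ι : Type*} [Fintype ι] [DecidableEq ι] (M : Matrix ι ι ℂ) : Prop :=
  ∃ Q : Matrix ι ι ℂ, IsUnit Q.det ∧ (Q⁻¹ * M * Q).IsDiag

/-- The `T`-periodic system `dx/dt = A_ε(t) x`, whose leading order is constant and diagonal, is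
posed at a first order asymptotic exceptional point. -/
def IsFirstOrderAsymptoticEP {ι : Type*} [Fintype ι] [DecidableEq ι] (T : ℝ)
    (A : ℝ → ℝ → Matrix ι ι ℂ) : Prop :=
  ∃ F₁ : Matrix ι ι ℂ,
    IsFirstOrderFloquet T (A 0 0) (firstOrderCoeff A) (constantOrderFloquet T (A 0 0)) F₁ ∧
    ∀ ε : ℝ, 0 < ε →
      ¬ IsDiagonalizableMatrix (effectiveHamiltonian (constantOrderFloquet T (A 0 0)) F₁ ε)

/-- `f` has a finite Fourier series of frequency `Ω`. -/
def HasFiniteFourierSeries (Ω : ℝ) (f : ℝ → ℝ) : Prop :=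
  ∃ c : ℤ →₀ ℂ, ∀ t : ℝ, (f t : ℂ) = c.sum fun n a => a * Complex.exp (Complex.I * n * Ω * t)

/-- The `n`-th Fourier coefficient `f^(n)` of a function `f` of period `2π/Ω`. -/
noncomputable def modeCoeff {Ω : ℝ} (hΩ : 0 < Ω) (f : ℝ → ℝ) (n : ℤ) : ℂ :=
  fourierCoeffOn (div_pos Real.two_pi_pos hΩ) (fun t => (f t : ℂ)) n

/-! ### The dimer of time-modulated subwavelength resonators

The contrast is `δ`, the volume of each of the two resonators is `V`, the capacitance matrix is `C`;
the modulations are `1/κ_i = 1 + ε γ_i` and `1/ρ_i = 1 + ε η_i`. The unmodulated wave speed inside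
the resonators is normalized to `1`. -/

/-- The material parameter `1 / (1 + ε f(t))`: `κ_i` for `f = γ_i` and `ρ_i` for `f = η_i`. -/
noncomputable def modulated (f : ℝ → ℝ) (ε t : ℝ) : ℝ := 1 / (1 + ε * f t)

/-- Time-dependent contrast `δ_i(t) = δ ρ_i(t)`. -/
noncomputable def contrast (δ : ℝ) (η : ℝ → ℝ) (ε t : ℝ) : ℝ := δ * modulated η ε t

/-- Time-dependent wave speed `v_i(t) = √(κ_i(t) / ρ_i(t))`. -/
noncomputable def waveSpeed (γ η : ℝ → ℝ) (ε t : ℝ) : ℝ :=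
  Real.sqrt (modulated γ ε t / modulated η ε t)

/-- The diagonal entries `v_i δ_i^{3/2} / |D_i|` of `W₁`. -/
noncomputable def hillW₁ (δ V : ℝ) (γ η : ℝ → ℝ) (ε t : ℝ) : ℝ :=
  waveSpeed γ η ε t * contrast δ η ε t ^ (3 / 2 : ℝ) / V

/-- The diagonal entries `v_i / √δ_i` of `W₂`. -/
noncomputable def hillW₂ (δ : ℝ) (γ η : ℝ → ℝ) (ε t : ℝ) : ℝ :=
  waveSpeed γ η ε t / Real.sqrt (contrast δ η ε t)

/-- The product `δ_i v_i²`. -/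
noncomputable def contrastSpeedSq (δ : ℝ) (γ η : ℝ → ℝ) (ε t : ℝ) : ℝ :=
  contrast δ η ε t * waveSpeed γ η ε t ^ 2

/-- The diagonal entries `(√δ_i v_i / 2) d/dt ((δ_i v_i²)^{-3/2} d(δ_i v_i²)/dt)` of `W₃`. -/
noncomputable def hillW₃ (δ : ℝ) (γ η : ℝ → ℝ) (ε t : ℝ) : ℝ :=
  Real.sqrt (contrast δ η ε t) * waveSpeed γ η ε t / 2 *
    deriv (fun s => 1 / contrastSpeedSq δ γ η ε s ^ (3 / 2 : ℝ) *
      deriv (contrastSpeedSq δ γ η ε) s) t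

/-- The matrix `M(t) = W₁ C W₂ + W₃` of the Hill system `Ψ'' + M(t) Ψ = 0` of the dimer. -/
noncomputable def hillMatrix (δ V : ℝ) (C : Matrix (Fin 2) (Fin 2) ℂ) (γ η : Fin 2 → ℝ → ℝ)
    (ε t : ℝ) : Matrix (Fin 2) (Fin 2) ℂ :=
  Matrix.diagonal (fun i => (hillW₁ δ V (γ i) (η i) ε t : ℂ)) * C *
      Matrix.diagonal (fun i => (hillW₂ δ (γ i) (η i) ε t : ℂ)) +
    Matrix.diagonal (fun i => (hillW₃ δ (γ i) (η i) ε t : ℂ))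

/-- The coefficient matrix of the Hill system written as a first order system for
`(Ψ₁, Ψ₂, Ψ₁', Ψ₂')`. -/
noncomputable def hillFirstOrder (δ V : ℝ) (C : Matrix (Fin 2) (Fin 2) ℂ) (γ η : Fin 2 → ℝ → ℝ)
    (ε t : ℝ) : Matrix (Fin 4) (Fin 4) ℂ :=
  let M := hillMatrix δ V C γ η ε t
  !![0, 0, 1, 0;
     0, 0, 0, 1;
     -M 0 0, -M 0 1, 0, 0;
     -M 1 0, -M 1 1, 0, 0]

/-- The coefficient matrix `A_ε(t)` of the dimer system in the coordinates `Φ` given by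
`(Ψ, Ψ') = Q Φ`. -/
noncomputable def dimerSystem (δ V : ℝ) (C : Matrix (Fin 2) (Fin 2) ℂ) (γ η : Fin 2 → ℝ → ℝ)
    (Q : Matrix (Fin 4) (Fin 4) ℂ) (ε t : ℝ) : Matrix (Fin 4) (Fin 4) ℂ :=
  Q⁻¹ * hillFirstOrder δ V C γ η ε t * Q

/-- `α = √((C₁₁ - C₂₂)² + 4 |C₁₂|²)`. -/
noncomputable def capAlpha (C : Matrix (Fin 2) (Fin 2) ℂ) : ℝ :=
  Real.sqrt (((C 0 0).re - (C 1 1).re) ^ 2 + 4 * ‖C 0 1‖ ^ 2)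

/-- `√(C₁₁ + C₂₂ + α)`. -/
noncomputable def capRootPlus (C : Matrix (Fin 2) (Fin 2) ℂ) : ℝ :=
  Real.sqrt ((C 0 0).re + (C 1 1).re + capAlpha C)

/-- `√(C₁₁ + C₂₂ - α)`. -/
noncomputable def capRootMinus (C : Matrix (Fin 2) (Fin 2) ℂ) : ℝ :=
  Real.sqrt ((C 0 0).re + (C 1 1).re - capAlpha C)

/-- The ratio `R = √(C₁₁ C₂₂ - |C₁₂|²) / √((C₁₁ - C₂₂)² + 4 |C₁₂|²)`. -/
noncomputable def capRatio (C : Matrix (Fin 2) (Fin 2) ℂ) : ℝ :=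
  Real.sqrt ((C 0 0).re * (C 1 1).re - ‖C 0 1‖ ^ 2) / capAlpha C

/-- The diagonal leading order coefficient matrix `A₀` of the dimer system. -/
noncomputable def dimerA₀ (δ V : ℝ) (C : Matrix (Fin 2) (Fin 2) ℂ) : Matrix (Fin 4) (Fin 4) ℂ :=
  (((Real.sqrt δ / Real.sqrt (2 * V) : ℝ) : ℂ) * Complex.I) •
    Matrix.diagonal ![-(capRootPlus C : ℂ), (capRootPlus C : ℂ),
      -(capRootMinus C : ℂ), (capRootMinus C : ℂ)]

/-! Write `A₀ = diag(iθ_k)` with `θ = (-p, p, -m, m)`. At order zero `P₀ = diag(exp(i N_k Ω t))`,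
where `N_k` is the folding number. At order one each entry satisfies a scalar linear equation. When
`(F₀)_kk = (F₀)_ll`, periodicity is a solvability condition, and it forces `(F₁)_kl` to be the
Fourier coefficient of `(A₁)_kl` at mode `N_k - N_l`, that is, at the `n` with `θ_k - θ_l = nΩ`
(`IsFirstOrderFloquet.apply_of_resonant`).

Expanding the Hill matrix in `ε` and using that the columns of `Q` and the rows of `Q⁻¹` come from
right and left eigenvectors of `C`, this coefficient is a nonzero factor times an explicit
combination of modes of `γ_i` and `η_i` (`exists_firstOrder_trigPoly`). If `θ_k² ≠ θ_l²`, only the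
differences `g = γ₁ - γ₂`, `h = η₁ - η₂` survive, and `(F₁)_kl = 0` reads `θ_k θ_l g^(n) = (θ_k² -
θ_l²) h^(n)`. Since `R = pm / (p² - m²)`, this is one of the two stated equations. Exchanging `k`
and `l` flips the sign of the right side and conjugates the modes, which yields the other equation.

The zero means of `γ_i` kill the diagonal of `F₁`. A resonant two-by-two block therefore has equal
diagonal entries, and it fails to be diagonalizable exactly when one off-diagonal entry vanishes and
the other does not. The resonances `p - m ∈ ℤΩ` and `p + m ∈ ℤΩ` exclude each other by
irrationality, so either of them splits the indices into two separate pairs. If neither occurs, only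
the pairs `±p` and `±m` can resonate; there the `η` terms cancel and the two couplings vanish
together, so no exceptional point arises. -/

/-! ### Diagonalizability of matrices with blocks of size two -/

theorem isDiagonalizableMatrix_of_mul_eq {ι : Type*} [Fintype ι] [DecidableEq ι]
    {M Q : Matrix ι ι ℂ} {d : ι → ℂ} (hQ : IsUnit Q.det) (h : M * Q = Q * Matrix.diagonal d) :
    IsDiagonalizableMatrix M := by
  refine ⟨Q, hQ, ?_⟩
  rw [Matrix.mul_assoc, h, ← Matrix.mul_assoc, Matrix.nonsing_inv_mul _ hQ, Matrix.one_mul]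
  exact Matrix.isDiag_diagonal d

theorem IsDiagonalizableMatrix.of_submatrix {ι : Type*} [Fintype ι] [DecidableEq ι]
    {M : Matrix ι ι ℂ} (e : ι ≃ ι) (h : IsDiagonalizableMatrix (M.submatrix e e)) :
    IsDiagonalizableMatrix M := by
  obtain ⟨Q, hQ, hd⟩ := h
  refine ⟨Q.submatrix e.symm e.symm, by rwa [Matrix.det_submatrix_equiv_self], ?_⟩
  have hM : M = (M.submatrix e e).submatrix e.symm e.symm := by simp
  rw [hM, Matrix.inv_submatrix_equiv, Matrix.submatrix_mul_equiv, Matrix.submatrix_mul_equiv]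
  exact hd.submatrix e.symm.injective

/-- A nilpotent vector of `M - d` of a diagonalizable matrix `M` is an eigenvector. -/
theorem IsDiagonalizableMatrix.mulVec_eq_zero_of_sq {ι : Type*} [Fintype ι] [DecidableEq ι]
    {M : Matrix ι ι ℂ} (h : IsDiagonalizableMatrix M) (d : ℂ) (x : ι → ℂ)
    (hx : (M - d • (1 : Matrix ι ι ℂ)).mulVec ((M - d • (1 : Matrix ι ι ℂ)).mulVec x) = 0) :
    (M - d • (1 : Matrix ι ι ℂ)).mulVec x = 0 := by
  obtain ⟨Q, hQ, hd⟩ := h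
  have hQi : Q⁻¹ * Q = 1 := Matrix.nonsing_inv_mul _ hQ
  have hQi' : Q * Q⁻¹ = 1 := Matrix.mul_nonsing_inv _ hQ
  set N := M - d • (1 : Matrix ι ι ℂ) with hN
  have key : Q⁻¹ * N = Matrix.diagonal (fun i => (Q⁻¹ * M * Q).diag i - d) * Q⁻¹ := by
    have h1 : Matrix.diagonal (fun i => (Q⁻¹ * M * Q).diag i - d) =
        Q⁻¹ * M * Q - d • (1 : Matrix ι ι ℂ) := by
      rw [← (Matrix.isDiag_iff_diagonal_diag _).1 hd]
      ext i j
      by_cases hij : i = j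
      · subst hij; simp
      · simp [hij]
    rw [h1, Matrix.sub_mul, Matrix.mul_assoc _ Q, hQi', hN, Matrix.mul_sub]
    simp
  -- In the eigenbasis `N` is diagonal, and a diagonal matrix kills a vector as soon as its square
  -- does.
  have hy : (Matrix.diagonal (fun i => (Q⁻¹ * M * Q).diag i - d)).mulVec (Q⁻¹.mulVec x) = 0 := by
    have h2 := congrArg (Q⁻¹).mulVec hx
    rw [Matrix.mulVec_mulVec, key, ← Matrix.mulVec_mulVec, Matrix.mulVec_mulVec _ Q⁻¹, key,
      ← Matrix.mulVec_mulVec, Matrix.mulVec_zero] at h2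
    funext i
    have h3 := congrFun h2 i
    simp only [Matrix.mulVec_diagonal, Pi.zero_apply, mul_eq_zero] at h3 ⊢
    tauto
  have : N.mulVec x = Q.mulVec ((Q⁻¹ * N).mulVec x) := by
    rw [Matrix.mulVec_mulVec, ← Matrix.mul_assoc, hQi', Matrix.one_mul]
  rw [this, key, ← Matrix.mulVec_mulVec, hy, Matrix.mulVec_zero]

/-- A matrix with a Jordan block `[[d, b], [0, d]]` in the rows and columns `k`, `l`, which does
not couple to the other indices, is not diagonalizable. -/
theorem not_isDiagonalizableMatrix_of_jordan {ι : Type*} [Fintype ι] [DecidableEq ι]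
    {M : Matrix ι ι ℂ} {k l : ι} (hkl : k ≠ l) (hd : M k k = M l l)
    (hk : ∀ j, j ≠ k → M j k = 0) (hl : ∀ j, j ≠ k → j ≠ l → M j l = 0) (hb : M k l ≠ 0) :
    ¬ IsDiagonalizableMatrix M := by
  intro h
  have h1 : (M - M l l • (1 : Matrix ι ι ℂ)).mulVec (Pi.single l 1) = M k l • Pi.single k 1 := by
    funext j
    by_cases hjl : j = l
    · subst hjl; simp [hkl.symm]
    · by_cases hjk : j = k
      · subst hjk; simp [hkl]
      · simp [hjl, hjk, hl j hjk hjl]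
  have h2 : (M - M l l • (1 : Matrix ι ι ℂ)).mulVec (Pi.single k 1) = 0 := by
    funext j
    by_cases hjk : j = k
    · subst hjk; simp [hd]
    · simp [hjk, hk j hjk]
  have h3 := h.mulVec_eq_zero_of_sq (M l l) (Pi.single l 1) (by
    rw [h1, Matrix.mulVec_smul, h2, smul_zero])
  rw [h1] at h3
  simpa [hb] using congrFun h3 k

/-- With `b = u²` and `c = v²` nonzero, and `d = d'`, the eigenvectors are `(u, ±v)` with
eigenvalues `d ± uv`. Otherwise the block is already diagonal. -/
theorem exists_eigenbasis_fin_two (d d' b c : ℂ) (h : d ≠ d' → b = 0)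
    (hbc : b = 0 ↔ c = 0) :
    ∃ p q r s x y : ℂ, p * s - q * r ≠ 0 ∧ d * p + b * r = p * x ∧ d * q + b * s = q * y ∧
      c * p + d' * r = r * x ∧ c * q + d' * s = s * y := by
  by_cases hb : b = 0
  · refine ⟨1, 0, 0, 1, d, d', by simp, ?_⟩
    simp [hb, hbc.1 hb]
  · have hc : c ≠ 0 := fun h0 => hb (hbc.2 h0)
    obtain rfl : d = d' := by by_contra h0; exact hb (h h0)
    obtain ⟨u, rfl⟩ := IsAlgClosed.exists_pow_nat_eq b two_pos
    obtain ⟨v, rfl⟩ := IsAlgClosed.exists_pow_nat_eq c two_pos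
    refine ⟨u, u, v, -v, d + u * v, d - u * v, ?_, by ring, by ring, by ring, by ring⟩
    have hu : u ≠ 0 := by rintro rfl; simp at hb
    have hv : v ≠ 0 := by rintro rfl; simp at hc
    rw [show u * -v - u * v = -2 * (u * v) by ring]
    exact mul_ne_zero (by norm_num) (mul_ne_zero hu hv)

/-- A block diagonal matrix with two blocks of size two, each of which is diagonal or has equal
diagonal entries and non-zero off-diagonal ones, is diagonalizable. -/
theorem isDiagonalizableMatrix_of_pairs {M : Matrix (Fin 4) (Fin 4) ℂ}
    (h02 : M 0 2 = 0) (h03 : M 0 3 = 0) (h12 : M 1 2 = 0) (h13 : M 1 3 = 0)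
    (h20 : M 2 0 = 0) (h21 : M 2 1 = 0) (h30 : M 3 0 = 0) (h31 : M 3 1 = 0)
    (h01 : M 0 0 ≠ M 1 1 → M 0 1 = 0) (h01' : M 0 1 = 0 ↔ M 1 0 = 0)
    (h23 : M 2 2 ≠ M 3 3 → M 2 3 = 0) (h23' : M 2 3 = 0 ↔ M 3 2 = 0) :
    IsDiagonalizableMatrix M := by
  obtain ⟨p, q, r, s, x, y, hdet, e1, e2, e3, e4⟩ := exists_eigenbasis_fin_two _ _ _ _ h01 h01'
  obtain ⟨p', q', r', s', x', y', hdet', e1', e2', e3', e4'⟩ :=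
    exists_eigenbasis_fin_two _ _ _ _ h23 h23'
  refine isDiagonalizableMatrix_of_mul_eq
    (Q := !![p, q, 0, 0; r, s, 0, 0; 0, 0, p', q'; 0, 0, r', s']) (d := ![x, y, x', y']) ?_ ?_
  · have : (!![p, q, 0, 0; r, s, 0, 0; 0, 0, p', q'; 0, 0, r', s'] : Matrix _ _ ℂ).det =
        (p * s - q * r) * (p' * s' - q' * r') := by
      simp [Matrix.det_succ_row_zero, Fin.sum_univ_succ, Fin.succAbove]
      ring
    rw [this]
    exact (mul_ne_zero hdet hdet').isUnit
  · ext i j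
    fin_cases i <;> fin_cases j <;>
      simp [Matrix.mul_apply, Fin.sum_univ_succ, *]

/-! ### Trigonometric polynomials and Fourier coefficients -/

/-- The trigonometric polynomial `∑_{n ∈ S} c_n e^{inΩt}`. -/
noncomputable def trigPoly (Ω : ℝ) (S : Finset ℤ) (c : ℤ → ℂ) (t : ℝ) : ℂ :=
  ∑ n ∈ S, c n * Complex.exp (Complex.I * n * Ω * t)

theorem trigPoly_sub (Ω : ℝ) (S : Finset ℤ) (c d : ℤ → ℂ) (t : ℝ) :
    trigPoly Ω S c t - trigPoly Ω S d t = trigPoly Ω S (fun n => c n - d n) t := by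
  simp [trigPoly, sub_mul, Finset.sum_sub_distrib]

theorem hasDerivAt_cexp_mul (a : ℂ) (t : ℝ) :
    HasDerivAt (fun s : ℝ => Complex.exp (a * s)) (a * Complex.exp (a * t)) t := by
  have := ((hasDerivAt_id (t : ℂ)).const_mul a).cexp.comp_ofReal
  simpa [mul_comm] using this

theorem hasDerivAt_trigPoly (Ω : ℝ) (S : Finset ℤ) (c : ℤ → ℂ) (t : ℝ) :
    HasDerivAt (trigPoly Ω S c) (trigPoly Ω S (fun n => Complex.I * n * Ω * c n) t) t := by
  unfold trigPoly
  refine HasDerivAt.fun_sum fun n _ => ?_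
  refine ((hasDerivAt_cexp_mul (Complex.I * n * Ω) t).const_mul (c n)).congr_deriv ?_
  ring

theorem continuous_trigPoly (Ω : ℝ) (S : Finset ℤ) (c : ℤ → ℂ) : Continuous (trigPoly Ω S c) := by
  unfold trigPoly; fun_prop

theorem norm_trigPoly_le (Ω : ℝ) (S : Finset ℤ) (c : ℤ → ℂ) (t : ℝ) :
    ‖trigPoly Ω S c t‖ ≤ ∑ n ∈ S, ‖c n‖ := by
  refine (norm_sum_le _ _).trans (Finset.sum_le_sum fun n _ => ?_)
  rw [norm_mul, show Complex.I * n * Ω * t = ((n * Ω * t : ℝ) : ℂ) * Complex.I by push_cast; ring,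
    Complex.norm_exp_ofReal_mul_I, mul_one]

theorem cexp_period {Ω : ℝ} (hΩ : 0 < Ω) (m : ℤ) :
    Complex.exp (Complex.I * m * Ω * ((2 * Real.pi / Ω : ℝ) : ℂ)) = 1 := by
  have hΩ' : (Ω : ℂ) ≠ 0 := by exact_mod_cast hΩ.ne'
  rw [show Complex.I * m * Ω * ((2 * Real.pi / Ω : ℝ) : ℂ) = m * (2 * Real.pi * Complex.I) by
    push_cast; field_simp]
  exact Complex.exp_int_mul_two_pi_mul_I m

theorem integral_cexp_mode {Ω : ℝ} (hΩ : 0 < Ω) (m : ℤ) :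
    ∫ t in (0 : ℝ)..2 * Real.pi / Ω, Complex.exp (Complex.I * m * Ω * t) =
      if m = 0 then ((2 * Real.pi / Ω : ℝ) : ℂ) else 0 := by
  have hΩ' : (Ω : ℂ) ≠ 0 := by exact_mod_cast hΩ.ne'
  split_ifs with hm
  · subst hm; simp
  · have hm' : (m : ℂ) ≠ 0 := by exact_mod_cast hm
    rw [integral_exp_mul_complex (by simp [hm', hΩ']), cexp_period hΩ]
    simp

theorem integral_trigPoly_mul_mode {Ω : ℝ} (hΩ : 0 < Ω) {S : Finset ℤ} {c : ℤ → ℂ}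
    (hc : ∀ n, n ∉ S → c n = 0) (m : ℤ) :
    ∫ t in (0 : ℝ)..2 * Real.pi / Ω, Complex.exp (Complex.I * (-m : ℤ) * Ω * t) * trigPoly Ω S c t =
      ((2 * Real.pi / Ω : ℝ) : ℂ) * c m := by
  have h1 : ∀ t : ℝ, Complex.exp (Complex.I * (-m : ℤ) * Ω * t) * trigPoly Ω S c t =
      ∑ n ∈ S, c n * Complex.exp (Complex.I * (n - m : ℤ) * Ω * t) := by
    intro t
    rw [trigPoly, Finset.mul_sum]
    refine Finset.sum_congr rfl fun n _ => ?_
    rw [mul_left_comm, ← Complex.exp_add]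
    congr 2
    push_cast; ring
  simp_rw [h1]
  rw [intervalIntegral.integral_finsetSum fun n _ =>
    (Continuous.intervalIntegrable (by fun_prop) _ _)]
  simp_rw [intervalIntegral.integral_const_mul, integral_cexp_mode hΩ, sub_eq_zero]
  simp only [mul_ite, mul_zero, Finset.sum_ite_eq']
  split_ifs with h
  · ring
  · simp [hc m h]

theorem modeCoeff_eq_integral {Ω : ℝ} (hΩ : 0 < Ω) (f : ℝ → ℝ) (n : ℤ) :
    modeCoeff hΩ f n = ((2 * Real.pi / Ω : ℝ) : ℂ)⁻¹ *
      ∫ t in (0 : ℝ)..2 * Real.pi / Ω, Complex.exp (Complex.I * (-n : ℤ) * Ω * t) * f t := by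
  rw [modeCoeff, fourierCoeffOn_eq_integral, sub_zero, one_div, Complex.real_smul,
    Complex.ofReal_inv]
  congr 1
  refine intervalIntegral.integral_congr fun t _ => ?_
  have hΩ' : (Ω : ℂ) ≠ 0 := by exact_mod_cast hΩ.ne'
  have hpi : (Real.pi : ℂ) ≠ 0 := by exact_mod_cast Real.pi_ne_zero
  simp only [smul_eq_mul, fourier_coe_apply]
  congr 2
  push_cast
  field_simp

theorem modeCoeff_eq_of_trigPoly {Ω : ℝ} (hΩ : 0 < Ω) {f : ℝ → ℝ} {S : Finset ℤ} {c : ℤ → ℂ}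
    (hc : ∀ n, n ∉ S → c n = 0) (hf : ∀ t, (f t : ℂ) = trigPoly Ω S c t) (n : ℤ) :
    modeCoeff hΩ f n = c n := by
  rw [modeCoeff_eq_integral]
  simp_rw [hf]
  rw [integral_trigPoly_mul_mode hΩ hc, inv_mul_cancel_left₀]
  exact_mod_cast (div_pos Real.two_pi_pos hΩ).ne'

theorem modeCoeff_neg {Ω : ℝ} (hΩ : 0 < Ω) (f : ℝ → ℝ) (n : ℤ) :
    modeCoeff hΩ f (-n) = starRingEnd ℂ (modeCoeff hΩ f n) := by
  rw [modeCoeff_eq_integral, modeCoeff_eq_integral, map_mul, map_inv₀, Complex.conj_ofReal]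
  congr 1
  have hT := (div_pos Real.two_pi_pos hΩ).le
  rw [intervalIntegral.integral_of_le hT, intervalIntegral.integral_of_le hT, ← integral_conj]
  congr 1
  funext t
  rw [map_mul, Complex.conj_ofReal, ← Complex.exp_conj]
  simp

/-- Functions with a finite Fourier series, written with a common set of modes. -/
theorem exists_common_trigPoly {ι : Type*} [Fintype ι] {Ω : ℝ} {f : ι → ℝ → ℝ}
    (hf : ∀ i, HasFiniteFourierSeries Ω (f i)) :
    ∃ S : Finset ℤ, ∃ c : ι → ℤ → ℂ, (∀ i n, n ∉ S → c i n = 0) ∧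
      ∀ i t, (f i t : ℂ) = trigPoly Ω S (c i) t := by
  classical
  choose c hc using hf
  refine ⟨Finset.univ.biUnion fun i => (c i).support, fun i => c i, ?_, ?_⟩
  · intro i n hn
    simpa using fun h => hn (Finset.mem_biUnion.2 ⟨i, Finset.mem_univ i, h⟩)
  · intro i t
    rw [hc i t, trigPoly]
    exact Finsupp.sum_of_support_subset _ (Finset.subset_biUnion_of_mem
      (fun i => (c i).support) (Finset.mem_univ i)) _ (by simp)

/-- The real part of the differentiated sum is the derivative of `f`, and uniqueness of derivatives
shows that the sum is itself real. Being again of the assumed form, `f'` can be fed back to reach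
`γ''`. -/
theorem hasDerivAt_of_trigPoly {Ω : ℝ} {f : ℝ → ℝ} {S : Finset ℤ} {c : ℤ → ℂ}
    (hf : ∀ t, (f t : ℂ) = trigPoly Ω S c t) :
    ∃ f' : ℝ → ℝ, (∀ t, HasDerivAt f (f' t) t) ∧
      ∀ t, (f' t : ℂ) = trigPoly Ω S (fun n => Complex.I * n * Ω * c n) t := by
  have h1 : ∀ t, HasDerivAt f (trigPoly Ω S (fun n => Complex.I * n * Ω * c n) t).re t := by
    intro t
    have h2 := (Complex.reCLM.hasFDerivAt.comp_hasDerivAt t (hasDerivAt_trigPoly Ω S c t))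
    refine h2.congr_of_eventuallyEq (Filter.Eventually.of_forall fun s => ?_)
    simp [← hf]
  refine ⟨_, h1, fun t => ?_⟩
  have h3 := (h1 t).ofReal_comp
  simp_rw [hf] at h3
  exact h3.unique (hasDerivAt_trigPoly Ω S c t)

/-! ### First order Floquet expansion for a diagonal leading order -/

theorem eq_mul_cexp_of_hasDerivAt {p : ℝ → ℂ} {a : ℂ}
    (hp : ∀ t, HasDerivAt p (a * p t) t) (t : ℝ) : p t = p 0 * Complex.exp (a * t) := by
  have h1 : ∀ t, HasDerivAt (fun s : ℝ => Complex.exp (-a * s) * p s) 0 t := fun t =>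
    ((hasDerivAt_cexp_mul (-a) t).mul (hp t)).congr_deriv (by ring)
  have h2 := is_const_of_deriv_eq_zero (fun t => (h1 t).differentiableAt)
    (fun t => (h1 t).deriv) t 0
  simp only [Complex.ofReal_zero, mul_zero, Complex.exp_zero, one_mul] at h2
  rw [← h2, mul_right_comm, ← Complex.exp_add]
  simp

theorem leading_floquet_eq {ι : Type*} [Fintype ι] [DecidableEq ι] {a f : ι → ℂ}
    {P₀ : ℝ → Matrix ι ι ℂ} (h0 : P₀ 0 = 1)
    (hP : ∀ t k l, HasDerivAt (fun s => P₀ s k l)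
      ((Matrix.diagonal a * P₀ t - P₀ t * Matrix.diagonal f) k l) t) (t : ℝ) :
    P₀ t = Matrix.diagonal fun k => Complex.exp ((a k - f k) * t) := by
  ext k l
  have h1 := eq_mul_cexp_of_hasDerivAt (p := fun s => P₀ s k l) (a := a k - f l)
    (fun s => (hP s k l).congr_deriv (by
      simp only [Matrix.sub_apply, Matrix.diagonal_mul, Matrix.mul_diagonal]; ring)) t
  simp only [h0] at h1
  rw [h1]
  by_cases hkl : k = l
  · subst hkl; simp
  · simp [hkl]

theorem periodic_cexp_mode {Ω : ℝ} (hΩ : 0 < Ω) (m : ℤ) :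
    Function.Periodic (fun t : ℝ => Complex.exp (Complex.I * m * Ω * t)) (2 * Real.pi / Ω) := by
  intro t
  simp only [Complex.ofReal_add, mul_add, Complex.exp_add, cexp_period hΩ, mul_one]

/-- The resonant entries of the first order Floquet exponent matrix are Fourier coefficients of
the first order perturbation. -/
theorem IsFirstOrderFloquet.apply_of_resonant {ι : Type*} [Fintype ι] [DecidableEq ι] {Ω : ℝ}
    (hΩ : 0 < Ω) {a f : ι → ℂ} {N : ι → ℤ} (haf : ∀ k, a k - f k = Complex.I * N k * Ω)
    {A₁ : ℝ → Matrix ι ι ℂ} {F₁ : Matrix ι ι ℂ}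
    (h : IsFirstOrderFloquet (2 * Real.pi / Ω) (Matrix.diagonal a) A₁ (Matrix.diagonal f) F₁)
    {S : Finset ℤ} {α : ℤ → ℂ} {k l : ι} (hα : ∀ n, n ∉ S → α n = 0)
    (hA₁ : ∀ t, A₁ t k l = trigPoly Ω S α t) (hkl : f k = f l) :
    F₁ k l = α (N k - N l) := by
  obtain ⟨P₀, P₁, h0, h1, -, hper, hP₀, hP₁⟩ := h
  have hP := leading_floquet_eq h0 hP₀
  -- Integrating factor: at resonance `a k - f l = i N_k Ω`, so `q'` no longer contains `P₁`. Since
  -- `q` vanishes at both ends of a period, the mean of `q'` is zero.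
  set q : ℝ → ℂ := fun t => Complex.exp (-(Complex.I * N k * Ω) * t) * P₁ t k l with hq
  have hak : a k = f l + Complex.I * N k * Ω := by rw [← haf k, hkl]; ring
  have hd : ∀ t : ℝ, HasDerivAt q
      (Complex.exp (Complex.I * (-(N k - N l) : ℤ) * Ω * t) * trigPoly Ω S α t - F₁ k l) t := by
    intro t
    refine ((hasDerivAt_cexp_mul _ t).mul (hP₁ t k l)).congr_deriv ?_
    simp only [Matrix.sub_apply, Matrix.add_apply, Matrix.diagonal_mul, Matrix.mul_diagonal, hP,
      haf, hA₁, hak]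
    have e1 : Complex.exp (Complex.I * (-(N k - N l) : ℤ) * Ω * t) =
        Complex.exp (-(Complex.I * N k * Ω) * t) * Complex.exp (Complex.I * N l * Ω * t) := by
      rw [← Complex.exp_add]; congr 1; push_cast; ring
    have e2 : Complex.exp (-(Complex.I * N k * Ω) * t) * Complex.exp (Complex.I * N k * Ω * t) = 1 := by
      rw [← Complex.exp_add]; simp
    rw [e1]
    linear_combination (-F₁ k l) * e2
  have hint := intervalIntegral.integral_eq_sub_of_hasDerivAt (a := 0) (b := 2 * Real.pi / Ω)
    (fun t _ => hd t) (Continuous.intervalIntegrable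
      (by have := continuous_trigPoly Ω S α; fun_prop) _ _)
  have hqT : q (2 * Real.pi / Ω) = 0 := by
    have := hper 0
    rw [zero_add, h1] at this
    simp [hq, this]
  have hq0 : q 0 = 0 := by simp [hq, h1]
  rw [intervalIntegral.integral_sub (Continuous.intervalIntegrable
      (by have := continuous_trigPoly Ω S α; fun_prop) _ _) (by simp),
    integral_trigPoly_mul_mode hΩ hα, intervalIntegral.integral_const, hqT, hq0, sub_zero,
    sub_zero, Complex.real_smul, ← mul_sub] at hint
  have hT : ((2 * Real.pi / Ω : ℝ) : ℂ) ≠ 0 := by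
    exact_mod_cast (div_pos Real.two_pi_pos hΩ).ne'
  have := (mul_eq_zero.1 hint).resolve_left hT
  linear_combination -this

/-- One Fourier mode of the forcing in an entry of the first order equation; `c` is its contribution
to `F₁`. A resonant forcing is absorbed entirely by `c = 1`. Otherwise the response is divided by
`ijΩ - a`, and `c` is tuned so that an exponential of frequency `NΩ` can be subtracted to achieve `p
0 = 0`. -/
theorem exists_periodic_solution_mode {Ω : ℝ} (hΩ : 0 < Ω) (a : ℂ) (N j : ℤ)
    (ha : Complex.I * j * Ω = a → j = N) :
    ∃ (p : ℝ → ℂ) (c : ℂ), p 0 = 0 ∧ Function.Periodic p (2 * Real.pi / Ω) ∧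
      ∀ t : ℝ, HasDerivAt p (a * p t + Complex.exp (Complex.I * j * Ω * t) -
        c * Complex.exp (Complex.I * N * Ω * t)) t := by
  by_cases h : Complex.I * j * Ω = a
  · refine ⟨fun _ => 0, 1, rfl, fun _ => rfl, fun t => ?_⟩
    rw [ha h]
    simpa using hasDerivAt_const t (0 : ℂ)
  · have hne : Complex.I * j * Ω - a ≠ 0 := sub_ne_zero.2 h
    refine ⟨fun t => (Complex.I * j * Ω - a)⁻¹ * (Complex.exp (Complex.I * j * Ω * t) -
      Complex.exp (Complex.I * N * Ω * t)),
      (Complex.I * j * Ω - a)⁻¹ * (Complex.I * N * Ω - a), by simp, fun t => ?_, fun t => ?_⟩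
    · have h1 := periodic_cexp_mode hΩ j t
      have h2 := periodic_cexp_mode hΩ N t
      simp only at h1 h2 ⊢
      rw [h1, h2]
    · refine (((hasDerivAt_cexp_mul _ t).sub (hasDerivAt_cexp_mul _ t)).const_mul _).congr_deriv ?_
      have := inv_mul_cancel₀ hne
      linear_combination Complex.exp (Complex.I * j * Ω * t) * this

theorem exists_isFirstOrderFloquet {ι : Type*} [Fintype ι] [DecidableEq ι] {Ω : ℝ}
    (hΩ : 0 < Ω) {a f : ι → ℂ} {N : ι → ℤ} (haf : ∀ k, a k - f k = Complex.I * N k * Ω)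
    (hf : ∀ k l (m : ℤ), f k - f l = Complex.I * m * Ω → m = 0)
    {A₁ : ℝ → Matrix ι ι ℂ} {S : Finset ℤ} {α : ι → ι → ℤ → ℂ}
    (hA₁ : ∀ t k l, A₁ t k l = trigPoly Ω S (α k l) t) :
    ∃ F₁, IsFirstOrderFloquet (2 * Real.pi / Ω) (Matrix.diagonal a) A₁ (Matrix.diagonal f) F₁ := by
  have hex : ∀ k l n, ∃ (p : ℝ → ℂ) (c : ℂ), p 0 = 0 ∧ Function.Periodic p (2 * Real.pi / Ω) ∧
      ∀ t : ℝ, HasDerivAt p ((a k - f l) * p t + Complex.exp (Complex.I * (n + N l : ℤ) * Ω * t) -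
        c * Complex.exp (Complex.I * N k * Ω * t)) t := by
    intro k l n
    refine exists_periodic_solution_mode hΩ _ _ _ fun h => ?_
    -- A vanishing divisor makes `f k - f l` a multiple of `iΩ`, which folding allows only if it is
    -- zero; then the forcing frequency is that of `P₀`.
    have h1 := hf k l (n + N l - N k) (by
      push_cast at h ⊢
      linear_combination -h - haf k)
    omega
  choose p c hp0 hper hp using hex
  refine ⟨Matrix.of fun k l => ∑ n ∈ S, α k l n * c k l n,
    fun t => Matrix.diagonal fun k => Complex.exp (Complex.I * N k * Ω * t),
    fun t => Matrix.of fun k l => ∑ n ∈ S, α k l n * p k l n t, ?_, ?_, ?_, ?_, ?_, ?_⟩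
  · simp
  · ext k l; simp [hp0]
  · intro t
    dsimp only
    congr 1; funext k; exact periodic_cexp_mode hΩ (N k) t
  · intro t
    ext k l
    simp only [Matrix.of_apply]
    exact Finset.sum_congr rfl fun n _ => by rw [hper k l n t]
  · intro t k l
    simp only [Matrix.sub_apply, Matrix.mul_diagonal]
    by_cases hkl : k = l
    · subst hkl
      simp only [Matrix.diagonal_apply_eq]
      refine (hasDerivAt_cexp_mul _ t).congr_deriv ?_
      linear_combination (-Complex.exp (Complex.I * N k * Ω * t)) * haf k
    · simpa [hkl] using hasDerivAt_const t (0 : ℂ)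
  · intro t k l
    simp only [Matrix.sub_apply, Matrix.add_apply, Matrix.diagonal_mul, Matrix.mul_diagonal,
      Matrix.of_apply, hA₁]
    refine (HasDerivAt.fun_sum fun n _ => (hp k l n t).const_mul (α k l n)).congr_deriv ?_
    rw [trigPoly, Finset.mul_sum, Finset.sum_mul, Finset.sum_mul, Finset.mul_sum,
      ← Finset.sum_sub_distrib, ← Finset.sum_add_distrib, ← Finset.sum_sub_distrib]
    refine Finset.sum_congr rfl fun n _ => ?_
    have : Complex.exp (Complex.I * (n + N l : ℤ) * Ω * t) =
        Complex.exp (Complex.I * n * Ω * t) * Complex.exp (Complex.I * N l * Ω * t) := by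
      rw [← Complex.exp_add]; congr 1; push_cast; ring
    rw [this]
    ring

/-! ### Folding of the leading exponents -/

theorem sub_constantOrderFloquet {ι : Type*} [DecidableEq ι] {Ω : ℝ} (hΩ : 0 < Ω)
    (A₀ : Matrix ι ι ℂ) (k : ι) :
    A₀ k k - constantOrderFloquet (2 * Real.pi / Ω) A₀ k k =
      Complex.I * foldingNumber (2 * Real.pi / Ω) (A₀ k k) * Ω := by
  have hΩ' : (Ω : ℂ) ≠ 0 := by exact_mod_cast hΩ.ne'
  have hpi : (Real.pi : ℂ) ≠ 0 := by exact_mod_cast Real.pi_ne_zero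
  rw [constantOrderFloquet, Matrix.diagonal_apply_eq]
  push_cast
  field_simp
  ring

theorem foldingNumber_period {Ω : ℝ} (hΩ : 0 < Ω) (z : ℂ) :
    foldingNumber (2 * Real.pi / Ω) z = ⌈z.im / Ω - 1 / 2⌉ := by
  rw [foldingNumber]
  congr 2
  field_simp

theorem constantOrderFloquet_eq_iff {ι : Type*} [DecidableEq ι] {Ω : ℝ} (hΩ : 0 < Ω)
    (A₀ : Matrix ι ι ℂ) (k l : ι) :
    constantOrderFloquet (2 * Real.pi / Ω) A₀ k k = constantOrderFloquet (2 * Real.pi / Ω) A₀ l l ↔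
      ∃ n : ℤ, A₀ k k - A₀ l l = Complex.I * n * Ω := by
  have hk := sub_constantOrderFloquet hΩ A₀ k
  have hl := sub_constantOrderFloquet hΩ A₀ l
  constructor
  · intro h
    refine ⟨foldingNumber (2 * Real.pi / Ω) (A₀ k k) - foldingNumber (2 * Real.pi / Ω) (A₀ l l), ?_⟩
    push_cast
    linear_combination h + hk - hl
  · rintro ⟨n, hn⟩
    have him : (A₀ k k).im / Ω - 1 / 2 = ((A₀ l l).im / Ω - 1 / 2) + n := by
      have h1 := congrArg Complex.im hn
      simp at h1
      field_simp
      linarith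
    rw [foldingNumber_period hΩ] at hk hl
    -- An integer shift passes through the ceiling, so the folding numbers differ by exactly `n`.
    rw [him, Int.ceil_add_intCast] at hk
    push_cast at hk
    linear_combination hn - hk + hl

theorem constantOrderFloquet_sub_eq {ι : Type*} [DecidableEq ι] {Ω : ℝ} (hΩ : 0 < Ω)
    (A₀ : Matrix ι ι ℂ) (k l : ι) (m : ℤ)
    (h : constantOrderFloquet (2 * Real.pi / Ω) A₀ k k -
      constantOrderFloquet (2 * Real.pi / Ω) A₀ l l = Complex.I * m * Ω) : m = 0 := by
  have hk := sub_constantOrderFloquet hΩ A₀ k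
  have hl := sub_constantOrderFloquet hΩ A₀ l
  have heq := (constantOrderFloquet_eq_iff hΩ A₀ k l).2
    ⟨foldingNumber (2 * Real.pi / Ω) (A₀ k k) - foldingNumber (2 * Real.pi / Ω) (A₀ l l) + m, by
      push_cast; linear_combination h + hk - hl⟩
  have hΩ' : (Ω : ℂ) ≠ 0 := by exact_mod_cast hΩ.ne'
  rw [heq, sub_self] at h
  simpa [hΩ'] using h.symm

/-! ### Expansion of the Hill matrix in `ε` -/

theorem hasDerivAt_modulated (f : ℝ → ℝ) (t : ℝ) :
    HasDerivAt (fun ε => modulated f ε t) (-f t) 0 := by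
  unfold modulated
  have h := (((hasDerivAt_id (0 : ℝ)).mul_const (f t)).const_add 1).fun_inv (by simp)
  simpa using h

theorem modulated_zero (f : ℝ → ℝ) (t : ℝ) : modulated f 0 t = 1 := by simp [modulated]

theorem contrast_zero (δ : ℝ) (η : ℝ → ℝ) (t : ℝ) : contrast δ η 0 t = δ := by
  simp [contrast, modulated_zero]

theorem waveSpeed_zero (γ η : ℝ → ℝ) (t : ℝ) : waveSpeed γ η 0 t = 1 := by
  simp [waveSpeed, modulated_zero]

theorem hasDerivAt_waveSpeed (γ η : ℝ → ℝ) (t : ℝ) :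
    HasDerivAt (fun ε => waveSpeed γ η ε t) ((η t - γ t) / 2) 0 := by
  unfold waveSpeed
  have h := ((hasDerivAt_modulated γ t).fun_div (hasDerivAt_modulated η t)
    (by simp [modulated_zero])).sqrt (by simp [modulated_zero])
  refine h.congr_deriv ?_
  simp [modulated_zero]
  ring

theorem hasDerivAt_contrast (δ : ℝ) (η : ℝ → ℝ) (t : ℝ) :
    HasDerivAt (fun ε => contrast δ η ε t) (-(δ * η t)) 0 := by
  unfold contrast
  exact ((hasDerivAt_modulated η t).const_mul δ).congr_deriv (by ring)

theorem hasDerivAt_hillW₁ {δ : ℝ} (hδ : 0 < δ) (V : ℝ) (γ η : ℝ → ℝ) (t : ℝ) :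
    HasDerivAt (fun ε => hillW₁ δ V γ η ε t) (δ ^ (3 / 2 : ℝ) / V * (-(γ t) / 2 - η t)) 0 := by
  unfold hillW₁
  have h := ((hasDerivAt_waveSpeed γ η t).mul ((hasDerivAt_contrast δ η t).rpow_const
    (p := 3 / 2) (Or.inl (by simp [contrast_zero, hδ.ne'])))).div_const V
  refine h.congr_deriv ?_
  simp only [contrast_zero, waveSpeed_zero]
  have : δ ^ (3 / 2 : ℝ) = δ ^ (3 / 2 - 1 : ℝ) * δ := by
    rw [← Real.rpow_add_one hδ.ne']; norm_num
  rw [this]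
  ring

theorem hasDerivAt_hillW₂ {δ : ℝ} (hδ : 0 < δ) (γ η : ℝ → ℝ) (t : ℝ) :
    HasDerivAt (fun ε => hillW₂ δ γ η ε t) (1 / Real.sqrt δ * (-(γ t) / 2 + η t)) 0 := by
  unfold hillW₂
  have hs := (Real.sqrt_pos.2 hδ).ne'
  have h := (hasDerivAt_waveSpeed γ η t).fun_div ((hasDerivAt_contrast δ η t).sqrt
    (by simp [contrast_zero, hδ.ne'])) (by simp [contrast_zero, hs])
  refine h.congr_deriv ?_
  simp only [contrast_zero, waveSpeed_zero]
  have h2 := Real.sq_sqrt hδ.le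
  field_simp
  rw [h2]
  ring

theorem hillW₁_zero (δ V : ℝ) (γ η : ℝ → ℝ) (t : ℝ) :
    hillW₁ δ V γ η 0 t = δ ^ (3 / 2 : ℝ) / V := by
  simp [hillW₁, waveSpeed_zero, contrast_zero]

theorem hillW₂_zero (δ : ℝ) (γ η : ℝ → ℝ) (t : ℝ) : hillW₂ δ γ η 0 t = 1 / Real.sqrt δ := by
  simp [hillW₂, waveSpeed_zero, contrast_zero]

theorem hillW₃_zero (δ : ℝ) (γ η : ℝ → ℝ) (t : ℝ) : hillW₃ δ γ η 0 t = 0 := by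
  have : contrastSpeedSq δ γ η 0 = fun _ => δ := by
    funext s; simp [contrastSpeedSq, contrast_zero, waveSpeed_zero]
  simp [hillW₃, this]

theorem rpow_three_halves {x : ℝ} (hx : 0 ≤ x) : x ^ (3 / 2 : ℝ) = x * Real.sqrt x := by
  rw [show (3 / 2 : ℝ) = 1 + 1 / 2 by norm_num, Real.rpow_add' hx (by norm_num), Real.rpow_one,
    ← Real.sqrt_eq_rpow]

/-- In `δ_i v_i² = δ κ_i` the density cancels, so `W₃` depends on `γ` alone. Positivity is needed at
all times because the formula is differentiated in time. -/
theorem hillW₃_eq {δ : ℝ} (hδ : 0 < δ) {γ η γ' : ℝ → ℝ} {ε t γ'' : ℝ}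
    (hγ : ∀ s, HasDerivAt γ (γ' s) s) (hγ' : HasDerivAt γ' γ'' t)
    (hu : ∀ s, 0 < 1 + ε * γ s) (hw : ∀ s, 0 < 1 + ε * η s) :
    hillW₃ δ γ η ε t =
      -(ε / 2) * (γ'' / (1 + ε * γ t) - ε * γ' t ^ 2 / (2 * (1 + ε * γ t) ^ 2)) := by
  have hsδ := Real.sqrt_pos.2 hδ
  have h1 : contrastSpeedSq δ γ η ε = fun s => δ / (1 + ε * γ s) := by
    funext s
    have := hu s
    have := hw s
    rw [contrastSpeedSq, contrast, waveSpeed, modulated, modulated, Real.sq_sqrt (by positivity)]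
    field_simp
  have hdu : ∀ s, HasDerivAt (fun s => 1 + ε * γ s) (ε * γ' s) s := fun s =>
    ((hγ s).const_mul ε).const_add 1
  have h2 : deriv (contrastSpeedSq δ γ η ε) = fun s => -(δ * ε * γ' s) / (1 + ε * γ s) ^ 2 := by
    funext s
    rw [h1]
    have := ((hasDerivAt_const s δ).fun_div (hdu s) (hu s).ne').deriv
    rw [this]
    ring
  have h3 : (fun s => 1 / contrastSpeedSq δ γ η ε s ^ (3 / 2 : ℝ) *
      deriv (contrastSpeedSq δ γ η ε) s) =
      fun s => -(ε / Real.sqrt δ) * (γ' s / Real.sqrt (1 + ε * γ s)) := by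
    funext s
    have hp := hu s
    have hsp := Real.sqrt_pos.2 hp
    rw [h2, h1]
    simp only
    rw [rpow_three_halves (by positivity), Real.sqrt_div hδ.le]
    have e1 := Real.sq_sqrt hp.le
    field_simp
    rw [e1]
  have hp := hu t
  have hq := hw t
  have hsp := Real.sqrt_pos.2 hp
  have h4 : Real.sqrt (contrast δ η ε t) * waveSpeed γ η ε t =
      Real.sqrt δ / Real.sqrt (1 + ε * γ t) := by
    rw [contrast, waveSpeed, modulated, modulated, ← Real.sqrt_mul (by positivity),
      ← Real.sqrt_div hδ.le]
    congr 1
    field_simp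
  have h5 := ((hγ'.fun_div ((hdu t).sqrt hp.ne') hsp.ne').const_mul
    (-(ε / Real.sqrt δ))).deriv
  rw [hillW₃, h3, h5, h4]
  have e1 := Real.sq_sqrt hp.le
  have e2 : (1 + ε * γ t) ^ 2 = Real.sqrt (1 + ε * γ t) ^ 4 := by
    rw [show 4 = 2 * 2 by norm_num, pow_mul, e1]
  rw [e2]
  generalize Real.sqrt (1 + ε * γ t) = w at *
  rw [← e1]
  field_simp

theorem eventually_one_add_mul_pos {f : ℝ → ℝ} {B : ℝ} (hB : ∀ t, |f t| ≤ B) :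
    ∀ᶠ ε in nhds (0 : ℝ), ∀ s, 0 < 1 + ε * f s := by
  have hB0 : 0 ≤ B := (abs_nonneg _).trans (hB 0)
  have h : ∀ᶠ ε in nhds (0 : ℝ), |ε| * B < 1 := by
    have : Filter.Tendsto (fun ε : ℝ => |ε| * B) (nhds 0) (nhds (|0| * B)) :=
      (Continuous.tendsto (by fun_prop) _)
    rw [abs_zero, zero_mul] at this
    exact this.eventually (gt_mem_nhds one_pos)
  filter_upwards [h] with ε hε s
  have h1 : |ε * f s| ≤ |ε| * B := by
    rw [abs_mul]; exact mul_le_mul_of_nonneg_left (hB s) (abs_nonneg _)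
  linarith [neg_abs_le (ε * f s)]

theorem hasDerivAt_hillW₃ {δ : ℝ} (hδ : 0 < δ) {γ η γ' γ'' : ℝ → ℝ} {B B' : ℝ}
    (hγ : ∀ s, HasDerivAt γ (γ' s) s) (hγ' : ∀ s, HasDerivAt γ' (γ'' s) s)
    (hB : ∀ t, |γ t| ≤ B) (hB' : ∀ t, |η t| ≤ B') (t : ℝ) :
    HasDerivAt (fun ε => hillW₃ δ γ η ε t) (-(γ'' t) / 2) 0 := by
  have heq : (fun ε => hillW₃ δ γ η ε t) =ᶠ[nhds 0] fun ε =>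
      -(ε / 2) * (γ'' t / (1 + ε * γ t) - ε * γ' t ^ 2 / (2 * (1 + ε * γ t) ^ 2)) := by
    filter_upwards [eventually_one_add_mul_pos hB, eventually_one_add_mul_pos hB'] with ε h1 h2
    exact hillW₃_eq hδ hγ (hγ' t) h1 h2
  refine HasDerivAt.congr_of_eventuallyEq ?_ heq
  -- The prefactor `-(ε/2)` vanishes at `0`, so the derivative of the second factor never enters;
  -- its differentiability is enough.
  have hK : DifferentiableAt ℝ (fun ε : ℝ =>
      γ'' t / (1 + ε * γ t) - ε * γ' t ^ 2 / (2 * (1 + ε * γ t) ^ 2)) 0 := by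
    have h0 : (1 + 0 * γ t) ≠ 0 := by simp
    have h1 : 2 * (1 + 0 * γ t) ^ 2 ≠ 0 := by simp
    exact DifferentiableAt.fun_sub (DifferentiableAt.fun_div (by fun_prop) (by fun_prop) h0)
      (DifferentiableAt.fun_div (by fun_prop) (by fun_prop) h1)
  refine ((((hasDerivAt_id (0 : ℝ)).div_const 2).fun_neg).fun_mul hK.hasDerivAt).congr_deriv ?_
  simp
  ring

/-- The first order coefficient of the Hill matrix. -/
theorem hasDerivAt_hillMatrix {δ V : ℝ} (hδ : 0 < δ) (C : Matrix (Fin 2) (Fin 2) ℂ)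
    {γ η γ' γ'' : Fin 2 → ℝ → ℝ} {B B' : Fin 2 → ℝ}
    (hγ : ∀ i s, HasDerivAt (γ i) (γ' i s) s) (hγ' : ∀ i s, HasDerivAt (γ' i) (γ'' i s) s)
    (hB : ∀ i t, |γ i t| ≤ B i) (hB' : ∀ i t, |η i t| ≤ B' i) (t : ℝ) (i j : Fin 2) :
    HasDerivAt (fun ε : ℝ => hillMatrix δ V C γ η ε t i j)
      (((δ / V : ℝ) : ℂ) * C i j * (-(γ i t + γ j t) / 2 - η i t + η j t) -
        if i = j then (γ'' i t : ℂ) / 2 else 0) 0 := by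
  have hentry : (fun ε : ℝ => hillMatrix δ V C γ η ε t i j) = fun ε : ℝ =>
      (hillW₁ δ V (γ i) (η i) ε t : ℂ) * C i j * (hillW₂ δ (γ j) (η j) ε t : ℂ) +
        if i = j then (hillW₃ δ (γ i) (η i) ε t : ℂ) else 0 := by
    funext ε
    simp only [hillMatrix, Matrix.add_apply, Matrix.mul_diagonal, Matrix.diagonal_mul,
      Matrix.diagonal_apply]
  rw [hentry]
  have h1 := (hasDerivAt_hillW₁ hδ V (γ i) (η i) t).ofReal_comp
  have h2 := (hasDerivAt_hillW₂ hδ (γ j) (η j) t).ofReal_comp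
  have h3 := (hasDerivAt_hillW₃ hδ (hγ i) (hγ' i) (hB i) (hB' i) t).ofReal_comp
  have h4 : HasDerivAt (fun ε : ℝ => if i = j then (hillW₃ δ (γ i) (η i) ε t : ℂ) else 0)
      (if i = j then ((-(γ'' i t) / 2 : ℝ) : ℂ) else 0) 0 := by
    split_ifs
    · exact h3
    · exact hasDerivAt_const _ _
  refine (((h1.mul_const (C i j)).mul h2).add h4).congr_deriv ?_
  have hs := (Real.sqrt_pos.2 hδ).ne'
  have hs' : (Real.sqrt δ : ℂ) ≠ 0 := by exact_mod_cast hs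
  have hc : ((δ ^ (3 / 2 : ℝ) / V : ℝ) : ℂ) * (1 / Real.sqrt δ : ℝ) = ((δ / V : ℝ) : ℂ) := by
    rw [← Complex.ofReal_mul, rpow_three_halves hδ.le]
    congr 1
    field_simp
  simp only [hillW₁_zero, hillW₂_zero]
  rw [sub_eq_add_neg, ← hc]
  split_ifs <;> push_cast <;> ring

/-! ### Eigenvectors and first order coefficient of the dimer -/

/-- The signed natural frequencies `(-p, p, -m, m)`. -/
def signedFreq (p m : ℝ) : Fin 4 → ℝ := ![-p, p, -m, m]

theorem hillMatrix_zero {δ : ℝ} (hδ : 0 < δ) (V : ℝ) (C : Matrix (Fin 2) (Fin 2) ℂ)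
    (γ η : Fin 2 → ℝ → ℝ) (t : ℝ) (i j : Fin 2) :
    hillMatrix δ V C γ η 0 t i j = ((δ / V : ℝ) : ℂ) * C i j := by
  have hs := (Real.sqrt_pos.2 hδ).ne'
  have hc : ((δ ^ (3 / 2 : ℝ) / V : ℝ) : ℂ) * (1 / Real.sqrt δ : ℝ) = ((δ / V : ℝ) : ℂ) := by
    rw [← Complex.ofReal_mul, rpow_three_halves hδ.le]
    congr 1
    field_simp
  simp only [hillMatrix, Matrix.add_apply, Matrix.mul_diagonal, Matrix.diagonal_mul,
    hillW₁_zero, hillW₂_zero, hillW₃_zero, ← hc]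
  simp
  ring

/-- The left factor is arbitrary so that `L = 1` and `Q = 1` give the right and left eigenvector
equations, and `L = Q⁻¹` the change of basis. -/
theorem mul_hillFirstOrder_mul_apply (δ V : ℝ) (C : Matrix (Fin 2) (Fin 2) ℂ)
    (γ η : Fin 2 → ℝ → ℝ) (ε t : ℝ) (L Q : Matrix (Fin 4) (Fin 4) ℂ) (k l : Fin 4) :
    (L * hillFirstOrder δ V C γ η ε t * Q) k l = L k 0 * Q 2 l + L k 1 * Q 3 l -
      (L k 2 * (hillMatrix δ V C γ η ε t 0 0 * Q 0 l + hillMatrix δ V C γ η ε t 0 1 * Q 1 l) +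
       L k 3 * (hillMatrix δ V C γ η ε t 1 0 * Q 0 l + hillMatrix δ V C γ η ε t 1 1 * Q 1 l)) := by
  simp [Matrix.mul_apply, Fin.sum_univ_succ, hillFirstOrder]
  ring

/-- The eigenvectors of the unperturbed first order system. -/
theorem dimer_eigenvectors {δ V : ℝ} (hδ : 0 < δ) (hV : 0 < V)
    {C : Matrix (Fin 2) (Fin 2) ℂ} (hC₀₁ : C 0 1 ≠ 0) (hC₁₀ : C 1 0 ≠ 0)
    {γ η : Fin 2 → ℝ → ℝ} {Q : Matrix (Fin 4) (Fin 4) ℂ} (hQ : IsUnit Q.det) {a : Fin 4 → ℂ}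
    {t : ℝ} (hdiag : dimerSystem δ V C γ η Q 0 t = Matrix.diagonal a) (k : Fin 4) :
    (C 0 0 * Q 0 k + C 0 1 * Q 1 k = -(V / δ * a k ^ 2) * Q 0 k ∧
      C 1 0 * Q 0 k + C 1 1 * Q 1 k = -(V / δ * a k ^ 2) * Q 1 k ∧ Q 0 k ≠ 0) ∧
    (Q⁻¹ k 2 * C 0 0 + Q⁻¹ k 3 * C 1 0 = -(V / δ * a k ^ 2) * Q⁻¹ k 2 ∧
      Q⁻¹ k 2 * C 0 1 + Q⁻¹ k 3 * C 1 1 = -(V / δ * a k ^ 2) * Q⁻¹ k 3 ∧ Q⁻¹ k 2 ≠ 0) := by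
  have hQi : Q⁻¹ * Q = 1 := Matrix.nonsing_inv_mul _ hQ
  have hQi' : Q * Q⁻¹ = 1 := Matrix.mul_nonsing_inv _ hQ
  have hδ' : (δ : ℂ) ≠ 0 := by exact_mod_cast hδ.ne'
  have hV' : (V : ℂ) ≠ 0 := by exact_mod_cast hV.ne'
  rw [dimerSystem] at hdiag
  have hr : 1 * hillFirstOrder δ V C γ η 0 t * Q = Q * Matrix.diagonal a := by
    rw [← hdiag, ← Matrix.mul_assoc, ← Matrix.mul_assoc, hQi']
  have hl : Q⁻¹ * hillFirstOrder δ V C γ η 0 t * 1 = Matrix.diagonal a * Q⁻¹ := by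
    rw [← hdiag, Matrix.mul_assoc _ Q, hQi']
  have r : ∀ i, _ := fun i => congrFun (congrFun hr i) k
  have l : ∀ i, _ := fun i => congrFun (congrFun hl k) i
  simp only [mul_hillFirstOrder_mul_apply, Matrix.mul_diagonal, Matrix.diagonal_mul,
    hillMatrix_zero hδ] at r l
  have r0 := r 0; have r1 := r 1; have r2 := r 2; have r3 := r 3
  have l0 := l 0; have l1 := l 1; have l2 := l 2; have l3 := l 3
  simp at r0 r1 r2 r3 l0 l1 l2 l3
  have hone : ∑ i, Q⁻¹ k i * Q i k = 1 := by
    rw [← Matrix.mul_apply, hQi, Matrix.one_apply_eq]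
  rw [Fin.sum_univ_four] at hone
  rw [r0] at r2
  rw [r1] at r3
  rw [l2] at l0
  rw [l3] at l1
  field_simp at r2 r3 l0 l1
  have c1 : C 0 0 * Q 0 k + C 0 1 * Q 1 k = -(V / δ * a k ^ 2) * Q 0 k := by
    field_simp; linear_combination -r2
  have c2 : C 1 0 * Q 0 k + C 1 1 * Q 1 k = -(V / δ * a k ^ 2) * Q 1 k := by
    field_simp; linear_combination -r3
  have c3 : Q⁻¹ k 2 * C 0 0 + Q⁻¹ k 3 * C 1 0 = -(V / δ * a k ^ 2) * Q⁻¹ k 2 := by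
    field_simp; linear_combination -l0
  have c4 : Q⁻¹ k 2 * C 0 1 + Q⁻¹ k 3 * C 1 1 = -(V / δ * a k ^ 2) * Q⁻¹ k 3 := by
    field_simp; linear_combination -l1
  -- If the first component vanishes, `C₁₂ ≠ 0` kills the second, and then the whole column of `Q`
  -- or row of `Q⁻¹` is zero, against `Q⁻¹ * Q = 1`.
  refine ⟨⟨c1, c2, fun h => ?_⟩, ⟨c3, c4, fun h => ?_⟩⟩
  · have h1 : Q 1 k = 0 := by simpa [h, hC₀₁] using c1
    rw [r0, r1, h, h1] at hone
    simp at hone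
  · have h1 : Q⁻¹ k 3 = 0 := by simpa [h, hC₁₀] using c3
    rw [l2, l3, h, h1] at hone
    simp at hone

theorem firstOrderCoeff_dimerSystem {δ V : ℝ} (hδ : 0 < δ) (C : Matrix (Fin 2) (Fin 2) ℂ)
    {γ η γ' γ'' : Fin 2 → ℝ → ℝ} {B B' : Fin 2 → ℝ}
    (hγ : ∀ i s, HasDerivAt (γ i) (γ' i s) s) (hγ' : ∀ i s, HasDerivAt (γ' i) (γ'' i s) s)
    (hB : ∀ i t, |γ i t| ≤ B i) (hB' : ∀ i t, |η i t| ≤ B' i)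
    (Q : Matrix (Fin 4) (Fin 4) ℂ) (t : ℝ) (k l : Fin 4) :
    firstOrderCoeff (dimerSystem δ V C γ η Q) t k l =
      -(Q⁻¹ k 2 * ((((δ / V : ℝ) : ℂ) * C 0 0 * (-γ 0 t) - γ'' 0 t / 2) * Q 0 l +
          ((δ / V : ℝ) : ℂ) * C 0 1 * (-(γ 0 t + γ 1 t) / 2 - η 0 t + η 1 t) * Q 1 l) +
        Q⁻¹ k 3 * (((δ / V : ℝ) : ℂ) * C 1 0 * (-(γ 0 t + γ 1 t) / 2 - η 1 t + η 0 t) * Q 0 l +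
          (((δ / V : ℝ) : ℂ) * C 1 1 * (-γ 1 t) - γ'' 1 t / 2) * Q 1 l)) := by
  have hM := hasDerivAt_hillMatrix (V := V) hδ C hγ hγ' hB hB' t
  rw [firstOrderCoeff, Matrix.of_apply]
  simp only [dimerSystem, mul_hillFirstOrder_mul_apply]
  refine HasDerivAt.deriv ?_
  refine (((((hM 0 0).mul_const _).add ((hM 0 1).mul_const _)).const_mul _).add
    ((((hM 1 0).mul_const _).add ((hM 1 1).mul_const _)).const_mul _)).const_sub _
    |>.congr_deriv ?_
  simp only [↓reduceIte, zero_ne_one, one_ne_zero]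
  ring

/-- Here `x k + C₁₁` is the eigenvalue of `C` belonging to `θ k`, so the eigenvectors are
proportional to `(C₁₂, x k)` and `x k` is a root of a quadratic. These relations eliminate the
off-diagonal entries of `C` from the resonant coefficients. -/
theorem exists_firstOrder_trigPoly {δ V Ω : ℝ} (hδ : 0 < δ) (hV : 0 < V) (hΩ : 0 < Ω)
    {C : Matrix (Fin 2) (Fin 2) ℂ} (hC : C.IsHermitian) (hC₁₂ : C 0 1 ≠ 0)
    {γ η : Fin 2 → ℝ → ℝ}
    (hγ : ∀ i, HasFiniteFourierSeries Ω (γ i)) (hη : ∀ i, HasFiniteFourierSeries Ω (η i))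
    {Q : Matrix (Fin 4) (Fin 4) ℂ} (hQ : IsUnit Q.det) {θ : Fin 4 → ℝ} {t₀ : ℝ}
    (hdiag : dimerSystem δ V C γ η Q 0 t₀ = Matrix.diagonal fun k => Complex.I * θ k)
    {x : Fin 4 → ℝ} (hx : ∀ k, x k = V / δ * θ k ^ 2 - (C 0 0).re) :
    (∀ k, x k * (x k + (C 0 0).re - (C 1 1).re) = ‖C 0 1‖ ^ 2) ∧
    ∃ (S : Finset ℤ) (α : Fin 4 → Fin 4 → ℤ → ℂ) (τ : Fin 4 → Fin 4 → ℂ),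
      (∀ k l n, n ∉ S → α k l n = 0) ∧
      (∀ t k l, firstOrderCoeff (dimerSystem δ V C γ η Q) t k l = trigPoly Ω S (α k l) t) ∧
      (∀ k l, τ k l ≠ 0) ∧
      ∀ k l (n : ℤ), θ k - θ l = n * Ω → α k l n = τ k l *
        (θ k * θ l * (‖C 0 1‖ ^ 2 * modeCoeff hΩ (γ 0) n + x k * x l * modeCoeff hΩ (γ 1) n) -
          (θ k ^ 2 - θ l ^ 2) *
            (‖C 0 1‖ ^ 2 * modeCoeff hΩ (η 0) n + x k * x l * modeCoeff hΩ (η 1) n)) := by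
  have hδ' : (δ : ℂ) ≠ 0 := by exact_mod_cast hδ.ne'
  have hV' : (V : ℂ) ≠ 0 := by exact_mod_cast hV.ne'
  have h10 : C 1 0 = starRingEnd ℂ (C 0 1) := (hC.apply 1 0).symm
  have hC₁₀ : C 1 0 ≠ 0 := by rw [h10]; simpa using hC₁₂
  have h00 : C 0 0 = ((C 0 0).re : ℂ) := (Complex.conj_eq_iff_re.1 (hC.apply 0 0)).symm
  have h11 : C 1 1 = ((C 1 1).re : ℂ) := (Complex.conj_eq_iff_re.1 (hC.apply 1 1)).symm
  have hP : C 0 1 * C 1 0 = ((‖C 0 1‖ : ℝ) : ℂ) ^ 2 := by rw [h10, Complex.mul_conj']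
  have heig := dimer_eigenvectors hδ hV hC₁₂ hC₁₀ hQ hdiag
  have hxc : ∀ k, -((V : ℂ) / δ * (Complex.I * θ k) ^ 2) = x k + C 0 0 := by
    intro k
    rw [h00, hx, mul_pow, Complex.I_sq]
    push_cast
    ring
  simp only [hxc] at heig
  have hψ : ∀ k, C 0 1 * Q 1 k = x k * Q 0 k := fun k => by
    linear_combination (heig k).1.1
  have hφ : ∀ k, C 1 0 * Q⁻¹ k 3 = x k * Q⁻¹ k 2 := fun k => by
    linear_combination (heig k).2.1
  refine ⟨fun k => ?_, ?_⟩
  · have h1 : (x k : ℂ) * (x k + C 0 0 - C 1 1) = C 0 1 * C 1 0 := by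
      have h2 : (x k * (x k + C 0 0 - C 1 1) - C 0 1 * C 1 0) * Q 0 k = 0 := by
        linear_combination (-(x k + C 0 0 - C 1 1)) * hψ k - C 0 1 * (heig k).1.2.1
      exact sub_eq_zero.1 ((mul_eq_zero.1 h2).resolve_right (heig k).1.2.2)
    rw [hP, h00, h11] at h1
    exact_mod_cast h1
  obtain ⟨S, c, hcS, hc⟩ := exists_common_trigPoly (Ω := Ω) (f := Sum.elim γ η)
    (by rintro (i | i); exacts [hγ i, hη i])
  choose γ' hγ' hγ't using fun i => hasDerivAt_of_trigPoly (hc (Sum.inl i))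
  choose γ'' hγ'' hγ''t using fun i => hasDerivAt_of_trigPoly (hγ't i)
  have hbd : ∀ (i : Fin 2 ⊕ Fin 2) t, |Sum.elim γ η i t| ≤ ∑ n ∈ S, ‖c i n‖ := fun i t => by
    have := norm_trigPoly_le Ω S (c i) t
    rwa [← hc i t, Complex.norm_real] at this
  have hmode : ∀ i n, modeCoeff hΩ (Sum.elim γ η i) n = c i n := fun i n =>
    modeCoeff_eq_of_trigPoly hΩ (hcS i) (hc i) n
  have hmγ : ∀ i n, modeCoeff hΩ (γ i) n = c (Sum.inl i) n := fun i => hmode (Sum.inl i)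
  have hmη : ∀ i n, modeCoeff hΩ (η i) n = c (Sum.inr i) n := fun i => hmode (Sum.inr i)
  have hcγ : ∀ i t, (γ i t : ℂ) = trigPoly Ω S (c (Sum.inl i)) t := fun i => hc (Sum.inl i)
  have hcη : ∀ i t, (η i t : ℂ) = trigPoly Ω S (c (Sum.inr i)) t := fun i => hc (Sum.inr i)
  set κ : ℂ := ((δ / V : ℝ) : ℂ) with hκ
  have hκθ : ∀ k, κ * (x k + C 0 0) = θ k ^ 2 := fun k => by
    rw [← hxc, hκ, mul_pow, Complex.I_sq]
    push_cast
    field_simp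
  let D : Fin 2 → ℤ → ℂ := fun i n => Complex.I * n * Ω * (Complex.I * n * Ω * c (Sum.inl i) n)
  refine ⟨S, fun k l n =>
      -(Q⁻¹ k 2 * ((κ * C 0 0 * (-c (Sum.inl 0) n) - D 0 n / 2) * Q 0 l +
          κ * C 0 1 * (-(c (Sum.inl 0) n + c (Sum.inl 1) n) / 2 -
            c (Sum.inr 0) n + c (Sum.inr 1) n) * Q 1 l) +
        Q⁻¹ k 3 * (κ * C 1 0 * (-(c (Sum.inl 0) n + c (Sum.inl 1) n) / 2 -
            c (Sum.inr 1) n + c (Sum.inr 0) n) * Q 0 l +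
          (κ * C 1 1 * (-c (Sum.inl 1) n) - D 1 n / 2) * Q 1 l)),
    fun k l => Q⁻¹ k 2 * Q 0 l / (C 0 1 * C 1 0), ?_, ?_, ?_, ?_⟩
  · intro k l n hn
    simp [D, hcS _ n hn]
  · intro t k l
    rw [firstOrderCoeff_dimerSystem (γ := γ) (η := η) hδ C hγ' hγ'' (fun i t => hbd (Sum.inl i) t)
      (fun i t => hbd (Sum.inr i) t), hγ''t, hγ''t, hcγ, hcγ, hcη, hcη]
    simp only [trigPoly, D]
    simp only [Finset.mul_sum, Finset.sum_mul, ← Finset.sum_add_distrib, ← Finset.sum_sub_distrib,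
      ← Finset.sum_neg_distrib, Finset.sum_div]
    exact Finset.sum_congr rfl fun n _ => by ring
  · intro k l
    exact div_ne_zero (mul_ne_zero (heig k).2.2.2 (heig l).1.2.2) (mul_ne_zero hC₁₂ hC₁₀)
  · intro k l n hn
    have hn' : (θ k : ℂ) - θ l = n * Ω := by exact_mod_cast hn
    rw [hmγ, hmγ, hmη, hmη, ← hP]
    have hQ1 : Q 1 l = x l * Q 0 l / C 0 1 := by rw [← hψ]; field_simp
    have hQ3 : Q⁻¹ k 3 = x k * Q⁻¹ k 2 / C 1 0 := by rw [← hφ]; field_simp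
    have e1 := (heig l).1.1
    have e2 := (heig l).1.2.1
    have e3 := (heig k).2.1
    have e4 := (heig k).2.2.1
    simp only [D]
    have hI := Complex.I_sq
    -- At resonance `γ''` contributes `-(θ_k - θ_l)²/2`, which combines with `(θ_k² + θ_l²)/2` from
    -- `W₁ C W₂` to give the factor `θ_k θ_l`.
    have hD : ∀ z : ℂ, Complex.I * n * Ω * (Complex.I * n * Ω * z) = -(θ k - θ l) ^ 2 * z := by
      intro z; rw [hn']; linear_combination (n * Ω) ^ 2 * z * hI
    rw [hD, hD]
    have hprod0 : Q⁻¹ k 2 * Q 0 l / (C 0 1 * C 1 0) * (C 0 1 * C 1 0) = Q⁻¹ k 2 * Q 0 l := by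
      field_simp
    have hprod1 : Q⁻¹ k 2 * Q 0 l / (C 0 1 * C 1 0) * (x k * x l) = Q⁻¹ k 3 * Q 1 l := by
      rw [hQ1, hQ3]; field_simp
    generalize c (Sum.inl 0) n = γ0
    generalize c (Sum.inl 1) n = γ1
    generalize c (Sum.inr 0) n = η0
    generalize c (Sum.inr 1) n = η1
    have hk := hκθ k
    have hl := hκθ l
    generalize Q⁻¹ k 2 * Q 0 l / (C 0 1 * C 1 0) = τ at *
    linear_combination (-κ * Q⁻¹ k 2 * (-γ0 / 2 - η0)) * e1 + (-κ * Q⁻¹ k 3 * (-γ1 / 2 - η1)) * e2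
      + (-κ * Q 0 l * (-γ0 / 2 + η0)) * e3 + (-κ * Q 1 l * (-γ1 / 2 + η1)) * e4
      + (Q⁻¹ k 2 * Q 0 l * (γ0 / 2 - η0) + Q⁻¹ k 3 * Q 1 l * (γ1 / 2 - η1)) * hk
      + (Q⁻¹ k 2 * Q 0 l * (γ0 / 2 + η0) + Q⁻¹ k 3 * Q 1 l * (γ1 / 2 + η1)) * hl
      - (θ k * θ l * γ0 - (θ k ^ 2 - θ l ^ 2) * η0) * hprod0
      - (θ k * θ l * γ1 - (θ k ^ 2 - θ l ^ 2) * η1) * hprod1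

/-! ### Resonant entries of `F₁` for the dimer -/

theorem modeCoeff_sub {Ω : ℝ} (hΩ : 0 < Ω) {f : Fin 2 → ℝ → ℝ}
    (hf : ∀ i, HasFiniteFourierSeries Ω (f i)) (n : ℤ) :
    modeCoeff hΩ (fun t => f 0 t - f 1 t) n = modeCoeff hΩ (f 0) n - modeCoeff hΩ (f 1) n := by
  obtain ⟨S, c, hcS, hc⟩ := exists_common_trigPoly hf
  rw [modeCoeff_eq_of_trigPoly hΩ (hcS 0) (hc 0), modeCoeff_eq_of_trigPoly hΩ (hcS 1) (hc 1)]
  refine modeCoeff_eq_of_trigPoly hΩ (S := S) (c := fun n => c 0 n - c 1 n) ?_ ?_ n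
  · intro n hn
    simp [hcS _ n hn]
  · intro t
    rw [Complex.ofReal_sub, hc, hc, trigPoly_sub]

theorem constantOrderFloquet_diagonal_eq_iff {ι : Type*} [DecidableEq ι] {Ω : ℝ} (hΩ : 0 < Ω)
    (θ : ι → ℝ) (k l : ι) :
    constantOrderFloquet (2 * Real.pi / Ω) (Matrix.diagonal fun k => Complex.I * θ k) k k =
      constantOrderFloquet (2 * Real.pi / Ω) (Matrix.diagonal fun k => Complex.I * θ k) l l ↔
      ∃ n : ℤ, θ k - θ l = n * Ω := by
  rw [constantOrderFloquet_eq_iff hΩ]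
  refine exists_congr fun n => ?_
  rw [Matrix.diagonal_apply_eq, Matrix.diagonal_apply_eq, ← mul_sub, mul_assoc,
    mul_right_inj' Complex.I_ne_zero]
  exact_mod_cast Iff.rfl

/-- The resonant entries of the first order Floquet exponent matrix of the dimer. -/
theorem dimer_firstOrderFloquet {δ V Ω : ℝ} (hδ : 0 < δ) (hV : 0 < V) (hΩ : 0 < Ω)
    {C : Matrix (Fin 2) (Fin 2) ℂ} (hC : C.IsHermitian) (hC₁₂ : C 0 1 ≠ 0)
    {γ η : Fin 2 → ℝ → ℝ}
    (hγ : ∀ i, HasFiniteFourierSeries Ω (γ i)) (hη : ∀ i, HasFiniteFourierSeries Ω (η i))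
    (hγ₀ : ∀ i, modeCoeff hΩ (γ i) 0 = 0)
    {Q : Matrix (Fin 4) (Fin 4) ℂ} (hQ : IsUnit Q.det) {θ : Fin 4 → ℝ} (hθ : ∀ k, θ k ≠ 0) {t₀ : ℝ}
    (hdiag : dimerSystem δ V C γ η Q 0 t₀ = Matrix.diagonal fun k => Complex.I * θ k) :
    let A₀ : Matrix (Fin 4) (Fin 4) ℂ := Matrix.diagonal fun k => Complex.I * θ k
    let F₀ := constantOrderFloquet (2 * Real.pi / Ω) A₀
    let g : ℤ → ℂ := modeCoeff hΩ (fun t => γ 0 t - γ 1 t)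
    let h : ℤ → ℂ := modeCoeff hΩ (fun t => η 0 t - η 1 t)
    (∃ F₁, IsFirstOrderFloquet (2 * Real.pi / Ω) A₀
      (firstOrderCoeff (dimerSystem δ V C γ η Q)) F₀ F₁) ∧
    ∀ F₁, IsFirstOrderFloquet (2 * Real.pi / Ω) A₀
      (firstOrderCoeff (dimerSystem δ V C γ η Q)) F₀ F₁ →
      (∀ k, F₁ k k = 0) ∧
      (∀ k l, F₀ k k = F₀ l l → θ k = -θ l → (F₁ k l = 0 ↔ F₁ l k = 0)) ∧
      ∀ k l (n : ℤ), θ k - θ l = n * Ω → θ k ^ 2 ≠ θ l ^ 2 →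
        (F₁ k l = 0 ↔ (θ k * θ l : ℂ) * g n = (θ k ^ 2 - θ l ^ 2) * h n) := by
  intro A₀ F₀ g h
  obtain ⟨x, hx⟩ : ∃ x : Fin 4 → ℝ, ∀ k, x k = V / δ * θ k ^ 2 - (C 0 0).re :=
    ⟨_, fun _ => rfl⟩
  obtain ⟨hchar, S, α, τ, hαS, hA₁, hτ, hα⟩ := exists_firstOrder_trigPoly hδ hV hΩ hC hC₁₂ hγ hη hQ
    hdiag hx
  have hF₀ : F₀ = Matrix.diagonal fun k => F₀ k k := by
    ext k l
    by_cases hkl : k = l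
    · subst hkl; simp
    · simp [F₀, constantOrderFloquet, hkl]
  have haf := fun k => sub_constantOrderFloquet hΩ A₀ k
  have hΩ' : (Ω : ℂ) ≠ 0 := by exact_mod_cast hΩ.ne'
  refine ⟨?_, fun F₁ hF₁ => ?_⟩
  · rw [hF₀]
    exact exists_isFirstOrderFloquet hΩ (a := fun k => Complex.I * θ k)
      (N := fun k => foldingNumber (2 * Real.pi / Ω) (A₀ k k))
      (fun k => by simpa [A₀] using haf k) (constantOrderFloquet_sub_eq hΩ A₀) hA₁
  rw [hF₀] at hF₁
  have hres : ∀ k l (n : ℤ), θ k - θ l = n * Ω → F₁ k l = α k l n := by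
    intro k l n hn
    have heq : F₀ k k = F₀ l l := (constantOrderFloquet_diagonal_eq_iff hΩ θ k l).2 ⟨n, hn⟩
    rw [hF₁.apply_of_resonant hΩ (N := fun k => foldingNumber (2 * Real.pi / Ω) (A₀ k k))
      (fun k => by simpa [A₀] using haf k) (hαS k l) (fun t => hA₁ t k l) heq]
    congr 1
    have e1 := haf k
    have e2 := haf l
    have hn' : (θ k : ℂ) - θ l = n * Ω := by exact_mod_cast hn
    change A₀ k k - F₀ k k = _ at e1
    change A₀ l l - F₀ l l = _ at e2
    rw [heq] at e1
    have e3 : Complex.I * Ω * ((foldingNumber (2 * Real.pi / Ω) (A₀ k k) : ℂ) -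
        foldingNumber (2 * Real.pi / Ω) (A₀ l l)) = Complex.I * Ω * n := by
      have e4 : A₀ k k - A₀ l l = Complex.I * (θ k - θ l) := by simp [A₀, mul_sub]
      rw [hn'] at e4
      linear_combination e4 - e1 + e2
    have e5 := mul_left_cancel₀ (mul_ne_zero Complex.I_ne_zero hΩ') e3
    exact_mod_cast e5
  refine ⟨fun k => ?_, fun k l hkl hopp => ?_, fun k l n hn hne => ?_⟩
  · rw [hres k k 0 (by simp), hα k k 0 (by simp), hγ₀, hγ₀]
    simp
  · obtain ⟨n, hn⟩ := (constantOrderFloquet_diagonal_eq_iff hΩ θ k l).1 hkl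
    have hn' : θ l - θ k = (-n : ℤ) * Ω := by push_cast; linarith
    have hsq : θ k ^ 2 = θ l ^ 2 := by rw [hopp]; ring
    have hsq' : (θ k : ℂ) ^ 2 - (θ l : ℂ) ^ 2 = 0 := by
      rw [sub_eq_zero]; exact_mod_cast hsq
    have hxx : x l = x k := by simp only [hx, hsq]
    have hsq'' : (θ l : ℂ) ^ 2 - (θ k : ℂ) ^ 2 = 0 := by linear_combination -hsq'
    have hk : (θ k : ℂ) ≠ 0 := by exact_mod_cast hθ k
    have hl : (θ l : ℂ) ≠ 0 := by exact_mod_cast hθ l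
    rw [hres k l n hn, hα k l n hn, hres l k _ hn', hα l k _ hn', hsq', hsq'', hxx, modeCoeff_neg,
      modeCoeff_neg]
    -- With the `η` terms gone and `x l = x k`, the two entries are, up to nonzero factors, the same
    -- real combination of the modes of `γ` at `n` and at `-n`, hence conjugate.
    simp only [zero_mul, sub_zero, mul_eq_zero, hτ, hk, hl, false_or]
    rw [← map_eq_zero (starRingEnd ℂ)]
    simp
  · rw [hres k l n hn, hα k l n hn]
    -- Vieta: `x k` and `x l` are the two distinct roots of the quadratic in `hchar`. This is what
    -- leaves only differences of modulations.
    have hxx : x k * x l = -‖C 0 1‖ ^ 2 := by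
      have h1 := hchar k
      have h2 := hchar l
      have hne' : x k - x l ≠ 0 := by
        have : x k - x l = V / δ * (θ k ^ 2 - θ l ^ 2) := by simp only [hx]; ring
        rw [this]
        exact mul_ne_zero (div_pos hV hδ).ne' (sub_ne_zero.2 hne)
      have h3 : x k + x l + (C 0 0).re - (C 1 1).re = 0 := by
        have : (x k - x l) * (x k + x l + (C 0 0).re - (C 1 1).re) = 0 := by
          linear_combination h1 - h2
        exact (mul_eq_zero.1 this).resolve_left hne'
      linear_combination x k * h3 - h1
    have hxx' : (x k : ℂ) * x l = -(‖C 0 1‖ : ℂ) ^ 2 := by exact_mod_cast hxx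
    have hP : (‖C 0 1‖ : ℂ) ^ 2 ≠ 0 := by
      have := norm_ne_zero_iff.2 hC₁₂
      exact_mod_cast pow_ne_zero 2 this
    simp only [g, h]
    rw [hxx', modeCoeff_sub hΩ hγ, modeCoeff_sub hΩ hη, mul_eq_zero, or_iff_right (hτ k l),
      ← sub_eq_zero (b := _ * _)]
    generalize modeCoeff hΩ (γ 0) n = γ0
    generalize modeCoeff hΩ (γ 1) n = γ1
    generalize modeCoeff hΩ (η 0) n = η0
    generalize modeCoeff hΩ (η 1) n = η1
    have hfac : (θ k : ℂ) * θ l * ((‖C 0 1‖ : ℂ) ^ 2 * γ0 + -(‖C 0 1‖ : ℂ) ^ 2 * γ1) -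
        ((θ k : ℂ) ^ 2 - θ l ^ 2) * ((‖C 0 1‖ : ℂ) ^ 2 * η0 + -(‖C 0 1‖ : ℂ) ^ 2 * η1) =
        (‖C 0 1‖ : ℂ) ^ 2 * (θ k * θ l * (γ0 - γ1) - (θ k ^ 2 - θ l ^ 2) * (η0 - η1)) := by ring
    rw [hfac, mul_eq_zero, or_iff_right hP]

/-! ### Diagonalizability of the effective Hamiltonian -/

theorem effectiveHamiltonian_apply_of_ne {ι : Type*} {F₀ F₁ : Matrix ι ι ℂ} {ε : ℝ} {k l : ι}
    (h : F₀ k k ≠ F₀ l l) : effectiveHamiltonian F₀ F₁ ε k l = 0 := by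
  simp [effectiveHamiltonian, h]

theorem effectiveHamiltonian_apply_of_eq {ι : Type*} {F₀ F₁ : Matrix ι ι ℂ} {ε : ℝ} {k l : ι}
    (h : F₀ k k = F₀ l l) : effectiveHamiltonian F₀ F₁ ε k l = F₀ k l + ε * F₁ k l := by
  simp [effectiveHamiltonian, h]

/-- If the resonances respect the pairing `{e 0, e 1}`, `{e 2, e 3}` and the coupling inside each
pair is mutual or absent, then the effective Hamiltonian is diagonalizable. -/
theorem isDiagonalizable_effectiveHamiltonian {F₀ F₁ : Matrix (Fin 4) (Fin 4) ℂ} {ε : ℝ}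
    (hε : ε ≠ 0) (hF₀ : F₀.IsDiag) (hF₁ : ∀ k, F₁ k k = 0) (e : Fin 4 ≃ Fin 4)
    (h02 : F₀ (e 0) (e 0) ≠ F₀ (e 2) (e 2)) (h03 : F₀ (e 0) (e 0) ≠ F₀ (e 3) (e 3))
    (h12 : F₀ (e 1) (e 1) ≠ F₀ (e 2) (e 2)) (h13 : F₀ (e 1) (e 1) ≠ F₀ (e 3) (e 3))
    (h01 : F₀ (e 0) (e 0) = F₀ (e 1) (e 1) → (F₁ (e 0) (e 1) = 0 ↔ F₁ (e 1) (e 0) = 0))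
    (h23 : F₀ (e 2) (e 2) = F₀ (e 3) (e 3) → (F₁ (e 2) (e 3) = 0 ↔ F₁ (e 3) (e 2) = 0)) :
    IsDiagonalizableMatrix (effectiveHamiltonian F₀ F₁ ε) := by
  have hε' : (ε : ℂ) ≠ 0 := by exact_mod_cast hε
  have hd : ∀ k, effectiveHamiltonian F₀ F₁ ε k k = F₀ k k := fun k => by
    rw [effectiveHamiltonian_apply_of_eq rfl, hF₁]; simp
  have hoff : ∀ k l, k ≠ l → F₀ k k = F₀ l l →
      effectiveHamiltonian F₀ F₁ ε k l = ε * F₁ k l := fun k l hkl h => by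
    rw [effectiveHamiltonian_apply_of_eq h, hF₀ hkl, zero_add]
  have hpair : ∀ k l, k ≠ l → (F₀ k k = F₀ l l → (F₁ k l = 0 ↔ F₁ l k = 0)) →
      (effectiveHamiltonian F₀ F₁ ε k l = 0 ↔ effectiveHamiltonian F₀ F₁ ε l k = 0) := by
    intro k l hkl h
    by_cases hf : F₀ k k = F₀ l l
    · rw [hoff k l hkl hf, hoff l k hkl.symm hf.symm]
      simpa [hε'] using h hf
    · rw [effectiveHamiltonian_apply_of_ne hf, effectiveHamiltonian_apply_of_ne (Ne.symm hf)]
  refine IsDiagonalizableMatrix.of_submatrix e (isDiagonalizableMatrix_of_pairs ?_ ?_ ?_ ?_ ?_ ?_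
    ?_ ?_ ?_ ?_ ?_ ?_) <;> simp only [Matrix.submatrix_apply, hd]
  · exact effectiveHamiltonian_apply_of_ne h02
  · exact effectiveHamiltonian_apply_of_ne h03
  · exact effectiveHamiltonian_apply_of_ne h12
  · exact effectiveHamiltonian_apply_of_ne h13
  · exact effectiveHamiltonian_apply_of_ne h02.symm
  · exact effectiveHamiltonian_apply_of_ne h12.symm
  · exact effectiveHamiltonian_apply_of_ne h03.symm
  · exact effectiveHamiltonian_apply_of_ne h13.symm
  · exact fun h => effectiveHamiltonian_apply_of_ne h
  · exact hpair _ _ (by simp) h01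
  · exact fun h => effectiveHamiltonian_apply_of_ne h
  · exact hpair _ _ (by simp) h23

/-- A one-sided resonant coupling makes the effective Hamiltonian non-diagonalizable. -/
theorem not_isDiagonalizable_effectiveHamiltonian {ι : Type*} [Fintype ι] [DecidableEq ι]
    {F₀ F₁ : Matrix ι ι ℂ} {ε : ℝ} (hε : ε ≠ 0) (hF₀ : F₀.IsDiag) (hF₁ : ∀ k, F₁ k k = 0)
    {k l : ι} (hkl : k ≠ l) (heq : F₀ k k = F₀ l l)
    (hne : ∀ j, j ≠ k → j ≠ l → F₀ j j ≠ F₀ k k) (h0 : F₁ l k = 0) (h1 : F₁ k l ≠ 0) :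
    ¬ IsDiagonalizableMatrix (effectiveHamiltonian F₀ F₁ ε) := by
  have hε' : (ε : ℂ) ≠ 0 := by exact_mod_cast hε
  refine not_isDiagonalizableMatrix_of_jordan hkl ?_ ?_ ?_ ?_
  · rw [effectiveHamiltonian_apply_of_eq rfl, effectiveHamiltonian_apply_of_eq rfl, hF₁, hF₁, heq]
  · intro j hj
    by_cases hjl : j = l
    · subst hjl
      rw [effectiveHamiltonian_apply_of_eq heq.symm, hF₀ hj, h0]
      simp
    · exact effectiveHamiltonian_apply_of_ne (hne j hj hjl)
  · intro j hj hjl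
    exact effectiveHamiltonian_apply_of_ne (heq ▸ hne j hj hjl)
  · rw [effectiveHamiltonian_apply_of_eq heq, hF₀ hkl]
    simp [hε', h1]

/-! ### Capacitance constants and resonance conditions -/

theorem dimerA₀_eq (δ V : ℝ) (C : Matrix (Fin 2) (Fin 2) ℂ) :
    dimerA₀ δ V C = Matrix.diagonal fun k => Complex.I *
      (signedFreq (Real.sqrt δ / Real.sqrt (2 * V) * capRootPlus C)
        (Real.sqrt δ / Real.sqrt (2 * V) * capRootMinus C) k : ℂ) := by
  rw [dimerA₀, Matrix.smul_eq_diagonal_mul, Matrix.diagonal_mul_diagonal]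
  congr 1
  funext k
  fin_cases k <;> simp [signedFreq] <;> ring

/-- A vanishing `s₋` would make the ratio `1`, or `0` by the convention for division by zero. As
`Real.sqrt` is zero on negative numbers, irrationality also forces both radicands to be positive. -/
theorem capRoot_pos {C : Matrix (Fin 2) (Fin 2) ℂ} (hC₁₂ : C 0 1 ≠ 0)
    (hirr : Irrational
      ((capRootPlus C - capRootMinus C) / (capRootPlus C + capRootMinus C))) :
    0 < capAlpha C ∧ 0 < capRootMinus C ∧
      capRootPlus C ^ 2 = (C 0 0).re + (C 1 1).re + capAlpha C ∧
      capRootMinus C ^ 2 = (C 0 0).re + (C 1 1).re - capAlpha C := by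
  have hP : 0 < ‖C 0 1‖ := norm_pos_iff.2 hC₁₂
  have hα : 0 < capAlpha C := Real.sqrt_pos.2 (by positivity)
  have hm : 0 < capRootMinus C := by
    refine lt_of_le_of_ne (Real.sqrt_nonneg _) fun h => ?_
    rw [← h, sub_zero, add_zero] at hirr
    by_cases h0 : capRootPlus C = 0
    · rw [h0, div_zero] at hirr
      exact not_irrational_zero hirr
    · rw [div_self h0] at hirr
      exact not_irrational_one hirr
  have hpos := Real.sqrt_pos.1 hm
  exact ⟨hα, hm, Real.sq_sqrt (by linarith), Real.sq_sqrt hpos.le⟩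

/-- The determinant of `C` is `(s₊ s₋ / 2)²` and `s₊² - s₋² = 2α`. The identity is homogeneous, so
it passes to `p` and `m`. -/
theorem capRatio_mul {C : Matrix (Fin 2) (Fin 2) ℂ} (hα : 0 < capAlpha C)
    (hm : 0 < capRootMinus C)
    (hp2 : capRootPlus C ^ 2 = (C 0 0).re + (C 1 1).re + capAlpha C)
    (hm2 : capRootMinus C ^ 2 = (C 0 0).re + (C 1 1).re - capAlpha C) :
    capRatio C * (capRootPlus C ^ 2 - capRootMinus C ^ 2) = capRootPlus C * capRootMinus C := by
  have hp : 0 ≤ capRootPlus C := Real.sqrt_nonneg _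
  have hα2 : capAlpha C ^ 2 = ((C 0 0).re - (C 1 1).re) ^ 2 + 4 * ‖C 0 1‖ ^ 2 :=
    Real.sq_sqrt (by positivity)
  have hdet : (C 0 0).re * (C 1 1).re - ‖C 0 1‖ ^ 2 =
      (capRootPlus C * capRootMinus C / 2) ^ 2 := by
    rw [div_pow, mul_pow, hp2, hm2]
    linear_combination (1 / 4) * hα2
  rw [capRatio, hdet, Real.sqrt_sq (by positivity), hp2, hm2]
  field_simp
  ring

theorem not_two_resonances {p m Ω : ℝ} (hΩ : Ω ≠ 0) (h : Irrational ((p - m) / (p + m)))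
    {j k : ℤ} (hj : p - m = j * Ω) (hk : p + m = k * Ω) : False := by
  rw [hj, hk, mul_div_mul_right _ _ hΩ] at h
  exact h ⟨(j / k : ℚ), by push_cast; rfl⟩

theorem exists_nat_mul_eq_iff {Ω q : ℝ} (hΩ : 0 < Ω) (hq : 0 < q) :
    (∃ n : ℤ, q = n * Ω) ↔ ∃ n : ℕ, 1 ≤ n ∧ (n : ℝ) * Ω = q := by
  constructor
  · rintro ⟨n, hn⟩
    have h0 : (0 : ℝ) < n := pos_of_mul_pos_left (hn ▸ hq) hΩ.le
    have h1 : 0 < n := by exact_mod_cast h0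
    lift n to ℕ using h1.le
    exact ⟨n, by exact_mod_cast h1, by rw [hn]; simp⟩
  · rintro ⟨n, -, hn⟩
    exact ⟨n, by rw [← hn]; simp⟩

theorem exists_int_neg_iff {Ω q : ℝ} : (∃ n : ℤ, -q = n * Ω) ↔ ∃ n : ℤ, q = n * Ω := by
  constructor <;> rintro ⟨n, hn⟩ <;> exact ⟨-n, by push_cast; linarith⟩

theorem conj_mul_eq_iff (r s : ℝ) (z w : ℂ) :
    (r : ℂ) * starRingEnd ℂ z = s * starRingEnd ℂ w ↔ (r : ℂ) * z = s * w := by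
  rw [← (starRingEnd ℂ).injective.eq_iff]
  simp

/-! ### Classification of the exceptional points -/

/-- Two resonant pairs `{i, j}` and `{k, l}`, which are coupled in the same way: the effective
Hamiltonian is diagonalizable if and only if the coupling is mutual or absent. -/
theorem isDiagonalizable_effectiveHamiltonian_iff {F₀ F₁ : Matrix (Fin 4) (Fin 4) ℂ} {ε : ℝ}
    (hε : ε ≠ 0) (hF₀ : F₀.IsDiag) (hF₁ : ∀ k, F₁ k k = 0) (e : Fin 4 ≃ Fin 4) {i j k l : Fin 4}
    (hi : e 0 = i) (hj : e 1 = j) (hk : e 2 = k) (hl : e 3 = l)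
    (hij : F₀ i i = F₀ j j) (hkl : F₀ k k = F₀ l l) (hik : F₀ i i ≠ F₀ k k) {X Y : Prop}
    (rij : F₁ i j = 0 ↔ X) (rji : F₁ j i = 0 ↔ Y) (rkl : F₁ k l = 0 ↔ X) (rlk : F₁ l k = 0 ↔ Y) :
    IsDiagonalizableMatrix (effectiveHamiltonian F₀ F₁ ε) ↔ (X ↔ Y) := by
  constructor
  · intro h
    have hne : i ≠ j := by subst hi hj; simp
    have hall : ∀ n, n ≠ i → n ≠ j → F₀ n n ≠ F₀ i i := by
      intro n hni hnj
      obtain ⟨n, rfl⟩ := e.surjective n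
      fin_cases n
      · exact absurd hi hni
      · exact absurd hj hnj
      · change F₀ (e 2) (e 2) ≠ _
        rw [hk]; exact hik.symm
      · change F₀ (e 3) (e 3) ≠ _
        rw [hl, ← hkl]; exact hik.symm
    rw [← rij, ← rji]
    constructor
    · intro h0
      by_contra h1
      exact not_isDiagonalizable_effectiveHamiltonian hε hF₀ hF₁ hne.symm hij.symm
        (fun n hnj hni => hij ▸ hall n hni hnj) h0 h1 h
    · intro h0
      by_contra h1
      exact not_isDiagonalizable_effectiveHamiltonian hε hF₀ hF₁ hne hij hall h0 h1 h
  · intro h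
    refine isDiagonalizable_effectiveHamiltonian hε hF₀ hF₁ e ?_ ?_ ?_ ?_ ?_ ?_ <;>
      simp only [hi, hj, hk, hl]
    · exact hik
    · exact hkl ▸ hik
    · exact hij ▸ hik
    · exact hij ▸ hkl ▸ hik
    · exact fun _ => rij.trans (h.trans rji.symm)
    · exact fun _ => rkl.trans (h.trans rlk.symm)

/-- Criterion for exceptional points of a dimer with natural frequencies `p` and `m`, in terms of
the entries of the first order Floquet exponent matrix. -/
theorem isFirstOrderAsymptoticEP_iff_of_entries {p m Ω R : ℝ} (hΩ : 0 < Ω) (hm : 0 < m)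
    (hmp : m < p) (hirr : Irrational ((p - m) / (p + m))) (hR : R * (p ^ 2 - m ^ 2) = p * m)
    {f₁ f₂ : ℝ → ℝ}
    {A : ℝ → ℝ → Matrix (Fin 4) (Fin 4) ℂ}
    (hA : A 0 0 = Matrix.diagonal fun k => Complex.I * (signedFreq p m k : ℂ))
    (hex : ∃ F₁, IsFirstOrderFloquet (2 * Real.pi / Ω) (A 0 0) (firstOrderCoeff A)
      (constantOrderFloquet (2 * Real.pi / Ω) (A 0 0)) F₁)
    (hF : ∀ F₁, IsFirstOrderFloquet (2 * Real.pi / Ω) (A 0 0) (firstOrderCoeff A)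
        (constantOrderFloquet (2 * Real.pi / Ω) (A 0 0)) F₁ →
      (∀ k, F₁ k k = 0) ∧
      (∀ k l, constantOrderFloquet (2 * Real.pi / Ω) (A 0 0) k k =
          constantOrderFloquet (2 * Real.pi / Ω) (A 0 0) l l →
        signedFreq p m k = -signedFreq p m l → (F₁ k l = 0 ↔ F₁ l k = 0)) ∧
      ∀ k l (n : ℤ), signedFreq p m k - signedFreq p m l = n * Ω →
        signedFreq p m k ^ 2 ≠ signedFreq p m l ^ 2 →
        (F₁ k l = 0 ↔ (signedFreq p m k * signedFreq p m l : ℂ) * modeCoeff hΩ f₁ n =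
          (signedFreq p m k ^ 2 - signedFreq p m l ^ 2) * modeCoeff hΩ f₂ n)) :
    IsFirstOrderAsymptoticEP (2 * Real.pi / Ω) A ↔
      (∃ n : ℕ, 1 ≤ n ∧ (n : ℝ) * Ω = p - m ∧
        Xor (-(R : ℂ) * modeCoeff hΩ f₁ n = modeCoeff hΩ f₂ n)
          ((R : ℂ) * modeCoeff hΩ f₁ n = modeCoeff hΩ f₂ n)) ∨
      (∃ n : ℕ, 1 ≤ n ∧ (n : ℝ) * Ω = p + m ∧
        Xor (-(R : ℂ) * modeCoeff hΩ f₁ n = modeCoeff hΩ f₂ n)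
          ((R : ℂ) * modeCoeff hΩ f₁ n = modeCoeff hΩ f₂ n)) := by
  set F₀ := constantOrderFloquet (2 * Real.pi / Ω) (A 0 0) with hF₀def
  have hF₀ : F₀.IsDiag := Matrix.isDiag_diagonal _
  have hE : ∀ k l, F₀ k k = F₀ l l ↔ ∃ n : ℤ, signedFreq p m k - signedFreq p m l = n * Ω := by
    intro k l
    rw [hF₀def, hA]
    exact constantOrderFloquet_diagonal_eq_iff hΩ _ k l
  have θ0 : signedFreq p m 0 = -p := rfl
  have θ1 : signedFreq p m 1 = p := rfl
  have θ2 : signedFreq p m 2 = -m := rfl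
  have θ3 : signedFreq p m 3 = m := rfl
  have E02 : F₀ 0 0 = F₀ 2 2 ↔ ∃ n : ℤ, p - m = n * Ω := by
    rw [hE, θ0, θ2, show -p - -m = -(p - m) by ring, exists_int_neg_iff]
  have E13 : F₀ 1 1 = F₀ 3 3 ↔ ∃ n : ℤ, p - m = n * Ω := by rw [hE, θ1, θ3]
  have E03 : F₀ 0 0 = F₀ 3 3 ↔ ∃ n : ℤ, p + m = n * Ω := by
    rw [hE, θ0, θ3, show -p - m = -(p + m) by ring, exists_int_neg_iff]
  have E12 : F₀ 1 1 = F₀ 2 2 ↔ ∃ n : ℤ, p + m = n * Ω := by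
    rw [hE, θ1, θ2, sub_neg_eq_add]
  have hsq : p ^ 2 - m ^ 2 ≠ 0 := by nlinarith
  have hsqC : ((p ^ 2 - m ^ 2 : ℝ) : ℂ) ≠ 0 := by exact_mod_cast hsq
  have hRC : (R : ℂ) * ((p ^ 2 - m ^ 2 : ℝ) : ℂ) = ((p * m : ℝ) : ℂ) := by exact_mod_cast hR
  have hX : ∀ z w : ℂ, ((p * m : ℝ) : ℂ) * z = ((p ^ 2 - m ^ 2 : ℝ) : ℂ) * w ↔ (R : ℂ) * z = w := by
    intro z w
    rw [← hRC, mul_comm (R : ℂ), mul_assoc, mul_right_inj' hsqC]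
  have hY : ∀ z w : ℂ, ((p * m : ℝ) : ℂ) * z = ((-(p ^ 2 - m ^ 2) : ℝ) : ℂ) * w ↔
      -(R : ℂ) * z = w := by
    intro z w
    rw [← neg_inj, neg_mul_eq_mul_neg, neg_mul_eq_neg_mul, Complex.ofReal_neg, neg_neg, hX,
      neg_mul_comm]
  -- the couplings at the resonances `nΩ = p - m`
  have hAres : ∀ F₁, IsFirstOrderFloquet (2 * Real.pi / Ω) (A 0 0) (firstOrderCoeff A) F₀ F₁ →
      ∀ n : ℕ, (n : ℝ) * Ω = p - m →
      (F₁ 1 3 = 0 ↔ (R : ℂ) * modeCoeff hΩ f₁ n = modeCoeff hΩ f₂ n) ∧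
      (F₁ 3 1 = 0 ↔ -(R : ℂ) * modeCoeff hΩ f₁ n = modeCoeff hΩ f₂ n) ∧
      (F₁ 0 2 = 0 ↔ (R : ℂ) * modeCoeff hΩ f₁ n = modeCoeff hΩ f₂ n) ∧
      (F₁ 2 0 = 0 ↔ -(R : ℂ) * modeCoeff hΩ f₁ n = modeCoeff hΩ f₂ n) := by
    intro F₁ h n hn
    obtain ⟨-, -, h3⟩ := hF F₁ h
    have e13 := h3 1 3 n (by rw [θ1, θ3]; simp [hn]) (by rw [θ1, θ3]; exact sub_ne_zero.1 hsq)
    have e31 := h3 3 1 (-n : ℤ) (by rw [θ1, θ3]; push_cast; linarith)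
      (by rw [θ1, θ3]; exact (sub_ne_zero.1 hsq).symm)
    have e02 := h3 0 2 (-n : ℤ) (by rw [θ0, θ2]; push_cast; linarith)
      (by rw [θ0, θ2, neg_sq, neg_sq]; exact sub_ne_zero.1 hsq)
    have e20 := h3 2 0 n (by rw [θ0, θ2]; push_cast; linarith)
      (by rw [θ0, θ2, neg_sq, neg_sq]; exact (sub_ne_zero.1 hsq).symm)
    -- Entries resonant at mode `-n` involve conjugate coefficients; since the weights are real, the
    -- conjugation can be undone by `conj_mul_eq_iff`.
    rw [modeCoeff_neg, modeCoeff_neg] at e31 e02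
    refine ⟨?_, ?_, ?_, ?_⟩
    · rw [e13, ← hX, θ1, θ3]; push_cast; rfl
    · rw [e31, ← hY, ← conj_mul_eq_iff, θ1, θ3]; push_cast; ring_nf
    · rw [e02, ← hX, ← conj_mul_eq_iff, θ0, θ2]; push_cast; ring_nf
    · rw [e20, ← hY, θ0, θ2]; push_cast; ring_nf
  -- the couplings at the resonances `nΩ = p + m`
  have hBres : ∀ F₁, IsFirstOrderFloquet (2 * Real.pi / Ω) (A 0 0) (firstOrderCoeff A) F₀ F₁ →
      ∀ n : ℕ, (n : ℝ) * Ω = p + m →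
      (F₁ 1 2 = 0 ↔ -(R : ℂ) * modeCoeff hΩ f₁ n = modeCoeff hΩ f₂ n) ∧
      (F₁ 2 1 = 0 ↔ (R : ℂ) * modeCoeff hΩ f₁ n = modeCoeff hΩ f₂ n) ∧
      (F₁ 0 3 = 0 ↔ -(R : ℂ) * modeCoeff hΩ f₁ n = modeCoeff hΩ f₂ n) ∧
      (F₁ 3 0 = 0 ↔ (R : ℂ) * modeCoeff hΩ f₁ n = modeCoeff hΩ f₂ n) := by
    intro F₁ h n hn
    obtain ⟨-, -, h3⟩ := hF F₁ h
    have e12 := h3 1 2 n (by rw [θ1, θ2]; push_cast; linarith)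
      (by rw [θ1, θ2, neg_sq]; exact sub_ne_zero.1 hsq)
    have e21 := h3 2 1 (-n : ℤ) (by rw [θ1, θ2]; push_cast; linarith)
      (by rw [θ1, θ2, neg_sq]; exact (sub_ne_zero.1 hsq).symm)
    have e03 := h3 0 3 (-n : ℤ) (by rw [θ0, θ3]; push_cast; linarith)
      (by rw [θ0, θ3, neg_sq]; exact sub_ne_zero.1 hsq)
    have e30 := h3 3 0 n (by rw [θ0, θ3]; push_cast; linarith)
      (by rw [θ0, θ3, neg_sq]; exact (sub_ne_zero.1 hsq).symm)
    rw [modeCoeff_neg, modeCoeff_neg] at e21 e03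
    refine ⟨?_, ?_, ?_, ?_⟩
    · rw [e12, ← hY, θ1, θ2, ← neg_inj]; push_cast; ring_nf
    · rw [e21, ← hX, ← conj_mul_eq_iff, θ1, θ2, ← neg_inj]; push_cast; ring_nf
    · rw [e03, ← hY, ← conj_mul_eq_iff, θ0, θ3, ← neg_inj]; push_cast; ring_nf
    · rw [e30, ← hX, θ0, θ3, ← neg_inj]; push_cast; ring_nf
  have hAdiag : ∀ F₁, IsFirstOrderFloquet (2 * Real.pi / Ω) (A 0 0) (firstOrderCoeff A) F₀ F₁ →
      ∀ n : ℕ, (n : ℝ) * Ω = p - m → ∀ ε : ℝ, ε ≠ 0 →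
      (IsDiagonalizableMatrix (effectiveHamiltonian F₀ F₁ ε) ↔
        ((R : ℂ) * modeCoeff hΩ f₁ n = modeCoeff hΩ f₂ n ↔
          -(R : ℂ) * modeCoeff hΩ f₁ n = modeCoeff hΩ f₂ n)) := by
    intro F₁ hF₁ n hn ε hε
    obtain ⟨r13, r31, r02, r20⟩ := hAres F₁ hF₁ n hn
    have hA' : ∃ n : ℤ, p - m = n * Ω := ⟨n, by rw [← hn]; simp⟩
    refine isDiagonalizable_effectiveHamiltonian_iff hε hF₀ (hF F₁ hF₁).1 (Equiv.swap 1 2)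
      (i := 0) (j := 2) (k := 1) (l := 3) (by decide) (by decide) (by decide) (by decide)
      (E02.2 hA') (E13.2 hA') (fun h => ?_) r02 r20 r13 r31
    -- If the two pairs shared an eigenvalue, all four would coincide, and `p + m` would be resonant
    -- as well.
    obtain ⟨k, hk⟩ := E03.1 (h.trans (E13.2 hA'))
    exact hA'.elim fun j hj => not_two_resonances hΩ.ne' hirr hj hk
  have hBdiag : ∀ F₁, IsFirstOrderFloquet (2 * Real.pi / Ω) (A 0 0) (firstOrderCoeff A) F₀ F₁ →
      ∀ n : ℕ, (n : ℝ) * Ω = p + m → ∀ ε : ℝ, ε ≠ 0 →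
      (IsDiagonalizableMatrix (effectiveHamiltonian F₀ F₁ ε) ↔
        (-(R : ℂ) * modeCoeff hΩ f₁ n = modeCoeff hΩ f₂ n ↔
          (R : ℂ) * modeCoeff hΩ f₁ n = modeCoeff hΩ f₂ n)) := by
    intro F₁ hF₁ n hn ε hε
    obtain ⟨r12, r21, r03, r30⟩ := hBres F₁ hF₁ n hn
    have hB : ∃ n : ℤ, p + m = n * Ω := ⟨n, by rw [← hn]; simp⟩
    refine isDiagonalizable_effectiveHamiltonian_iff hε hF₀ (hF F₁ hF₁).1
      (Equiv.swap 1 3 * Equiv.swap 2 3)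
      (i := 0) (j := 3) (k := 1) (l := 2) (by decide) (by decide) (by decide) (by decide)
      (E03.2 hB) (E12.2 hB) (fun h => ?_) r03 r30 r12 r21
    obtain ⟨j, hj⟩ := E02.1 (h.trans (E12.2 hB))
    exact hB.elim fun k hk => not_two_resonances hΩ.ne' hirr hj hk
  constructor
  · rintro ⟨F₁, hF₁, hEP⟩
    by_cases hA' : ∃ n : ℤ, p - m = n * Ω
    · obtain ⟨n, hn1, hn⟩ := (exists_nat_mul_eq_iff hΩ (sub_pos.2 hmp)).1 hA'
      -- The criterion does not depend on `ε`, so a single value suffices.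
      have h := hEP 1 one_pos
      rw [hAdiag F₁ hF₁ n hn 1 one_ne_zero, iff_comm, ← xor_iff_not_iff] at h
      exact Or.inl ⟨n, hn1, hn, h⟩
    by_cases hB : ∃ n : ℤ, p + m = n * Ω
    · obtain ⟨n, hn1, hn⟩ := (exists_nat_mul_eq_iff hΩ (add_pos (hm.trans hmp) hm)).1 hB
      have h := hEP 1 one_pos
      rw [hBdiag F₁ hF₁ n hn 1 one_ne_zero, ← xor_iff_not_iff] at h
      exact Or.inr ⟨n, hn1, hn, h⟩
    obtain ⟨h1, h2, -⟩ := hF F₁ hF₁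
    exact absurd (isDiagonalizable_effectiveHamiltonian one_ne_zero hF₀ h1 (Equiv.refl _)
      (fun h => hA' (E02.1 h)) (fun h => hB (E03.1 h)) (fun h => hB (E12.1 h))
      (fun h => hA' (E13.1 h)) (fun h => h2 0 1 h (by rw [θ0, θ1]))
      (fun h => h2 2 3 h (by rw [θ2, θ3]))) (hEP 1 one_pos)
  · obtain ⟨F₁, hF₁⟩ := hex
    rintro (⟨n, hn1, hn, hx⟩ | ⟨n, hn1, hn, hx⟩) <;> refine ⟨F₁, hF₁, fun ε hε => ?_⟩
    · rw [hAdiag F₁ hF₁ n hn ε hε.ne', iff_comm, ← xor_iff_not_iff]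
      exact hx
    · rw [hBdiag F₁ hF₁ n hn ε hε.ne', ← xor_iff_not_iff]
      exact hx

theorem mainTheorem11
    (δ V Ω : ℝ) (hδ : 0 < δ) (hV : 0 < V) (hΩ : 0 < Ω)
    (C : Matrix (Fin 2) (Fin 2) ℂ) (hC : C.IsHermitian) (hC₁₂ : C 0 1 ≠ 0)
    (hirr : Irrational
      ((capRootPlus C - capRootMinus C) / (capRootPlus C + capRootMinus C)))
    (γ η : Fin 2 → ℝ → ℝ)
    (hγ : ∀ i, HasFiniteFourierSeries Ω (γ i)) (hη : ∀ i, HasFiniteFourierSeries Ω (η i))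
    (hγ₀ : ∀ i, modeCoeff hΩ (γ i) 0 = 0)
    (Q : Matrix (Fin 4) (Fin 4) ℂ) (hQ : IsUnit Q.det)
    (hdiag : ∀ t, dimerSystem δ V C γ η Q 0 t = dimerA₀ δ V C) :
    let F₀ := constantOrderFloquet (2 * Real.pi / Ω) (dimerA₀ δ V C)
    let g : ℤ → ℂ := modeCoeff hΩ (fun t => γ 0 t - γ 1 t)
    let h : ℤ → ℂ := modeCoeff hΩ (fun t => η 0 t - η 1 t)
    let ΩA : ℕ → ℝ := fun n =>
      1 / n * (Real.sqrt δ / Real.sqrt (2 * V)) * (capRootPlus C - capRootMinus C)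
    let ΩB : ℕ → ℝ := fun n =>
      1 / n * (Real.sqrt δ / Real.sqrt (2 * V)) * (capRootPlus C + capRootMinus C)
    (F₀ 0 0 = F₀ 2 2 ∧ F₀ 1 1 = F₀ 3 3 ↔ ∃ n : ℕ, 1 ≤ n ∧ Ω = ΩA n) ∧
    (F₀ 0 0 = F₀ 3 3 ∧ F₀ 1 1 = F₀ 2 2 ↔ ∃ n : ℕ, 1 ≤ n ∧ Ω = ΩB n) ∧
    (IsFirstOrderAsymptoticEP (2 * Real.pi / Ω) (dimerSystem δ V C γ η Q) ↔
      (∃ n : ℕ, 1 ≤ n ∧ Ω = ΩA n ∧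
        Xor (-(capRatio C : ℂ) * g n = h n) ((capRatio C : ℂ) * g n = h n)) ∨
      (∃ n : ℕ, 1 ≤ n ∧ Ω = ΩB n ∧
        Xor (-(capRatio C : ℂ) * g n = h n) ((capRatio C : ℂ) * g n = h n))) := by
  intro F₀ g h ΩA ΩB
  obtain ⟨hα, hs, hp2, hm2⟩ := capRoot_pos hC₁₂ hirr
  have hsp : capRootMinus C < capRootPlus C := lt_of_pow_lt_pow_left₀ 2 (Real.sqrt_nonneg _)
    (by rw [hp2, hm2]; linarith)
  have hr : 0 < Real.sqrt δ / Real.sqrt (2 * V) := by positivity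
  have hcap := capRatio_mul hα hs hp2 hm2
  have hA₀ := dimerA₀_eq δ V C
  have hΩ_iff : ∀ (n : ℕ) (s : ℝ), 1 ≤ n →
      (Ω = 1 / n * (Real.sqrt δ / Real.sqrt (2 * V)) * s ↔
        (n : ℝ) * Ω = Real.sqrt δ / Real.sqrt (2 * V) * s) := by
    intro n s hn
    have : (n : ℝ) ≠ 0 := by exact_mod_cast (by omega : n ≠ 0)
    rw [mul_assoc, one_div, eq_inv_mul_iff_mul_eq₀ this]
  set r := Real.sqrt δ / Real.sqrt (2 * V)
  obtain ⟨p, hp⟩ : ∃ p, p = r * capRootPlus C := ⟨_, rfl⟩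
  obtain ⟨m, hm⟩ : ∃ m, m = r * capRootMinus C := ⟨_, rfl⟩
  have hΩA : ∀ n : ℕ, 1 ≤ n → (Ω = ΩA n ↔ (n : ℝ) * Ω = p - m) := fun n hn => by
    rw [hp, hm, ← mul_sub]; exact hΩ_iff n _ hn
  have hΩB : ∀ n : ℕ, 1 ≤ n → (Ω = ΩB n ↔ (n : ℝ) * Ω = p + m) := fun n hn => by
    rw [hp, hm, ← mul_add]; exact hΩ_iff n _ hn
  rw [← hp, ← hm] at hA₀
  have hm0 : 0 < m := hm ▸ mul_pos hr hs
  have hmp : m < p := by rw [hm, hp]; exact mul_lt_mul_of_pos_left hsp hr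
  have hirr' : Irrational ((p - m) / (p + m)) := by
    rwa [hp, hm, ← mul_sub, ← mul_add, mul_div_mul_left _ _ hr.ne']
  have hR : capRatio C * (p ^ 2 - m ^ 2) = p * m := by
    rw [hp, hm]; linear_combination r ^ 2 * hcap
  have hF₀ : ∀ k l, F₀ k k = F₀ l l ↔ ∃ n : ℤ, signedFreq p m k - signedFreq p m l = n * Ω := by
    intro k l
    simp only [F₀, hA₀]
    exact constantOrderFloquet_diagonal_eq_iff hΩ _ k l
  have hθ : ∀ k, signedFreq p m k ≠ 0 := by
    have := (hm0.trans hmp).ne'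
    have := hm0.ne'
    intro k
    fin_cases k <;> simpa [signedFreq]
  refine ⟨?_, ?_, ?_⟩
  · rw [exists_congr fun n => and_congr_right (hΩA n), ← exists_nat_mul_eq_iff hΩ (sub_pos.2 hmp),
      hF₀, hF₀]
    change (∃ n : ℤ, -p - -m = n * Ω) ∧ (∃ n : ℤ, p - m = n * Ω) ↔ _
    rw [show -p - -m = -(p - m) by ring, exists_int_neg_iff, and_self]
  · rw [exists_congr fun n => and_congr_right (hΩB n),
      ← exists_nat_mul_eq_iff hΩ (add_pos (hm0.trans hmp) hm0), hF₀, hF₀]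
    change (∃ n : ℤ, -p - m = n * Ω) ∧ (∃ n : ℤ, p - -m = n * Ω) ↔ _
    rw [show -p - m = -(p + m) by ring, exists_int_neg_iff, sub_neg_eq_add, and_self]
  · have hdiag₀ := hdiag 0
    rw [hA₀] at hdiag₀
    have hfloquet := dimer_firstOrderFloquet hδ hV hΩ hC hC₁₂ hγ hη hγ₀ hQ hθ hdiag₀
    have key := isFirstOrderAsymptoticEP_iff_of_entries hΩ hm0 hmp hirr' hR
      (f₁ := fun t => γ 0 t - γ 1 t) (f₂ := fun t => η 0 t - η 1 t) hdiag₀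
      (by rw [hdiag₀]; exact hfloquet.1) (by rw [hdiag₀]; exact hfloquet.2)
    rw [key]
    refine or_congr ?_ ?_ <;> refine exists_congr fun n => and_congr_right fun hn => ?_
    · rw [hΩA n hn]
    · rw [hΩB n hn]
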